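/- Theorem 4 (Circuit complexity from nonuniform proof complexity). Notation: circuits are fan-in-two Boolean circuits whose size is the number of gates; $\mathrm{Circuit}[s]$ is the class of single-output circuits of size at most $s$; fix a standard encoding of propositional formulas by $n$-bit strings, let $\mathrm{SAT}_n(x,y)$ say that $x\in\{0,1\}^n$ encodes a propositional formula satisfied by the assignment $y\in\{0,1\}^n$, and let $\mathrm{SAT}_n(x)=1$ iff $\mathrm{SAT}_n(x,y)$ for some $y$. For each sufficiently large $n$ (say $n\ge n_0$) and $s=n^k$ let: (i) $A_n\subseteq\{0,1\}^n$ be a set of size $\mathrm{poly}(s)$ such that, if $\mathrm{SAT}_n\notin\mathrm{Circuit}[s^3]$, then no single-output circuit of size at most $s$ agrees with $\mathrm{SAT}_n$ on all of $A_n$ ($A_n$ is a set of anticheckers; it is arbitrary of size $\mathrm{poly}(s)$ if $\mathrm{SAT}_n\in\mathrm{Circuit}[s^3]$); (ii) $B'_n$ be a single-output circuit with $n$ inputs and size at most $s^3$ such that $\mathrm{SAT}_n\in\mathrm{Circuit}[s^3]$ iff $B'_n(x)=\mathrm{SAT}_n(x)$ for all $x\in\{0,1\}^n$; (iii) $B_n$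 be a circuit with $n$ inputs, at most $n$ outputs and size $\mathrm{poly}(s)$ such that, if $B'_n$ computes $\mathrm{SAT}_n$, then $B_n$ solves the search version of $\mathrm{SAT}_n$: for all $x,y\in\{0,1\}^n$, $\mathrm{SAT}_n(x,y)$ implies $\mathrm{SAT}_n(x,B_n(x))$. Let $\alpha_n^{s}$ be the propositional tautology of size $\mathrm{poly}(s)$ $$\alpha_n^{s}:=\big(\mathrm{SAT}_n(x,y)\rightarrow \mathrm{SAT}_n(x,B_n(x))\big)\vee\bigvee_{z\in A_n} C(z)\neq \mathrm{SAT}_n(z),$$ where $x$, $y$ and the description of a single-output circuit $C$ with $n$ inputs and size $s$ are given by free variables, $A_n$, $B_n$ and the bits $\mathrm{SAT}_n(z)$, $z\in A_n$, are hard-wired, and evaluations of circuits and of encoded formulas are expressed with auxiliary free variables carrying the intermediate values. Let $k\ge 3$ be a constant. Suppose that some set of tautologies does not have polynomial-size Extended Frege derivations from substitution instances of the formulas $\alpha_n^{n^k}$, $n\ge n_0$; that is, there is no polynomial $p$ such that every tautology $\varphi$ in the set has, with $|\varphi|$ its number of symbols, an Extended Frege derivation of size at most $p(|\varphi|)$ in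 which substitution instances of the formulas $\alpha_n^{n^k}$, $n\ge n_0$, may be used as additional axioms. Then $\mathrm{SAT}_n\notin\mathrm{Circuit}[n^k]$ for infinitely many $n$. -/

import Mathlib

namespace EFAlpha

/-! ## Propositional formulas -/

/-- Propositional formulas over the set `V` of atoms, in the language `⊤, ⊥, ¬, ∧, ∨, →`. -/
inductive PForm (V : Type) : Type
  | var (v : V) : PForm V
  | tru : PForm V
  | fls : PForm V
  | neg (A : PForm V) : PForm V
  | and (A B : PForm V) : PForm V
  | or (A B : PForm V) : PForm V
  | imp (A B : PForm V) : PForm V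

namespace PForm

variable {V W : Type}

/-- The truth value of a formula under a truth assignment. -/
def eval (a : V → Bool) : PForm V → Bool
  | var v => a v
  | tru => true
  | fls => false
  | neg A => !(A.eval a)
  | and A B => A.eval a && B.eval a
  | or A B => A.eval a || B.eval a
  | imp A B => !(A.eval a) || B.eval a

/-- The size of a formula is its number of symbols (occurrences of atoms, constants and
connectives). -/
def size : PForm V → ℕ
  | var _ => 1
  | tru => 1
  | fls => 1
  | neg A => A.size + 1
  | and A B => A.size + B.size + 1
  | or A B => A.size + B.size + 1
  | imp A B => A.size + B.size + 1

/-- The atoms occurring in a formula. -/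
def vars : PForm V → Set V
  | var v => {v}
  | tru => ∅
  | fls => ∅
  | neg A => A.vars
  | and A B => A.vars ∪ B.vars
  | or A B => A.vars ∪ B.vars
  | imp A B => A.vars ∪ B.vars

/-- Simultaneous substitution of formulas for atoms. -/
def subst (σ : V → PForm W) : PForm V → PForm W
  | var v => σ v
  | tru => tru
  | fls => fls
  | neg A => neg (A.subst σ)
  | and A B => and (A.subst σ) (B.subst σ)
  | or A B => or (A.subst σ) (B.subst σ)
  | imp A B => imp (A.subst σ) (B.subst σ)

/-- A formula is a tautology if every truth assignment satisfies it. -/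
def Tautology (A : PForm V) : Prop := ∀ a : V → Bool, A.eval a = true

/-- `A ↔ B` as an abbreviation. -/
def iff (A B : PForm V) : PForm V := and (imp A B) (imp B A)

/-- The constant with a given truth value. -/
def const (b : Bool) : PForm V := if b then tru else fls

/-- `A = b` for a truth value `b`: `A` itself or its negation. -/
def lit (b : Bool) (A : PForm V) : PForm V := if b then A else neg A

/-- Conjunction of a list of formulas. -/
def conj (L : List (PForm V)) : PForm V := L.foldr and tru

/-- Disjunction of a list of formulas. -/
def disj (L : List (PForm V)) : PForm V := L.foldr or fls

end PForm

open PForm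

/-! ## Extended Frege -/

/-- The axiom schemes of a Frege system for the language `⊤, ⊥, ¬, ∧, ∨, →`. -/
inductive FregeAxiom : PForm ℕ → Prop
  | k (A B : PForm ℕ) : FregeAxiom (imp A (imp B A))
  | s (A B C : PForm ℕ) :
      FregeAxiom (imp (imp A (imp B C)) (imp (imp A B) (imp A C)))
  | andI (A B : PForm ℕ) : FregeAxiom (imp A (imp B (and A B)))
  | andL (A B : PForm ℕ) : FregeAxiom (imp (and A B) A)
  | andR (A B : PForm ℕ) : FregeAxiom (imp (and A B) B)
  | orL (A B : PForm ℕ) : FregeAxiom (imp A (or A B))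
  | orR (A B : PForm ℕ) : FregeAxiom (imp B (or A B))
  | orE (A B C : PForm ℕ) :
      FregeAxiom (imp (imp A C) (imp (imp B C) (imp (or A B) C)))
  | negI (A B : PForm ℕ) : FregeAxiom (imp (imp A B) (imp (imp A (neg B)) (neg A)))
  | negE (A : PForm ℕ) : FregeAxiom (imp (neg (neg A)) A)
  | truI : FregeAxiom tru
  | flsE (A : PForm ℕ) : FregeAxiom (imp fls A)

/-- `EFLines H E Γ`: the list `Γ` (last line first) is a sequence of lines of Extended Frege in
which members of `H` may be used as additional axioms, and `E` lists the extension atoms.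
Each line is an axiom, a member of `H`, follows from earlier lines by modus ponens,
or is an extension axiom `q ↔ D` whose atom `q` occurs neither in `D` nor in any earlier line. -/
inductive EFLines (H : Set (PForm ℕ)) : List ℕ → List (PForm ℕ) → Prop
  | nil : EFLines H [] []
  | ax {E : List ℕ} {Γ : List (PForm ℕ)} {A : PForm ℕ} :
      EFLines H E Γ → FregeAxiom A → EFLines H E (A :: Γ)
  | hyp {E : List ℕ} {Γ : List (PForm ℕ)} {A : PForm ℕ} :
      EFLines H E Γ → A ∈ H → EFLines H E (A :: Γ)
  | mp {E : List ℕ} {Γ : List (PForm ℕ)} {A B : PForm ℕ} :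
      EFLines H E Γ → A ∈ Γ → imp A B ∈ Γ → EFLines H E (B :: Γ)
  | ext {E : List ℕ} {Γ : List (PForm ℕ)} {q : ℕ} {D : PForm ℕ} :
      EFLines H E Γ → q ∉ D.vars → (∀ A ∈ Γ, q ∉ A.vars) →
      EFLines H (q :: E) (iff (var q) D :: Γ)

/-- `φ` has an EF-derivation from `H` of size (total number of symbols) at most `N`.
Extension atoms must not occur in the derived formula. -/
def EFDerivable (H : Set (PForm ℕ)) (φ : PForm ℕ) (N : ℕ) : Prop :=
  ∃ (E : List ℕ) (Γ : List (PForm ℕ)), EFLines H E (φ :: Γ) ∧ (∀ q ∈ E, q ∉ φ.vars) ∧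
    ((φ :: Γ).map PForm.size).sum ≤ N

/-- The formulas in `T` have EF-derivations from `H` whose size is bounded by one polynomial in
the size of the derived formula. -/
def HavePSizeEFDerivations (H T : Set (PForm ℕ)) : Prop :=
  ∃ c : ℕ, ∀ φ ∈ T, EFDerivable H φ (φ.size ^ c + c)

/-! ## Boolean circuits -/

/-- A gate of fan-in two: a binary Boolean function and the numbers of the two wires it reads. -/
structure Gate where
  op : Bool → Bool → Bool
  left : ℕ
  right : ℕ

/-- A circuit as a straight-line program. With `n` inputs, the wires `0, …, n - 1` are the
inputs and wire `n + g` carries the value of gate `g`; `outs` lists the output wires. -/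
structure Circuit where
  gates : List Gate
  outs : List ℕ

namespace Circuit

/-- The size of a circuit is its number of gates. -/
def size (C : Circuit) : ℕ := C.gates.length

/-- `C` is a circuit with `n` inputs: gates read only inputs and earlier gates, and outputs are
existing wires. -/
def WellFormed (C : Circuit) (n : ℕ) : Prop :=
  (∀ (g : ℕ) (h : g < C.gates.length),
    (C.gates[g]).left < n + g ∧ (C.gates[g]).right < n + g) ∧
  ∀ o ∈ C.outs, o < n + C.size

/-- Values of all wires. For a circuit with as many inputs as `x` has entries, the default value
`false` of `getD` is never used. -/
def wires (C : Circuit) (x : List Bool) : List Bool :=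
  C.gates.foldl (fun v G => v ++ [G.op (v.getD G.left false) (v.getD G.right false)]) x

/-- The `i`-th output bit on the input string `x`; missing output bits are read as `0`. -/
def outBit {n : ℕ} (C : Circuit) (x : Fin n → Bool) (i : ℕ) : Bool :=
  (C.outs.map fun o => (C.wires (List.ofFn x)).getD o false).getD i false

end Circuit

/-- `C` is a single-output circuit with `n` inputs and size at most `s`. -/
def IsCircuit (n s : ℕ) (C : Circuit) : Prop :=
  C.WellFormed n ∧ C.outs.length = 1 ∧ C.size ≤ s

/-! ## Satisfiability of formulas encoded by `n`-bit strings

A string of length `n` is cut into `n / (w + 3)` blocks of length `w + 3`, where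
`w = ⌊log₂ n⌋` (remaining bits are ignored). The first three bits of a block select one of eight
symbols, the other `w` bits are the binary index of an atom. The sequence of symbols is read as
a formula in reverse Polish notation, with blanks skipped. -/

/-- The `i`-th bit of a string (`0` beyond its end). -/
def bit {n : ℕ} (x : Fin n → Bool) (i : ℕ) : Bool := if h : i < n then x ⟨i, h⟩ else false

/-- Number of bits of the index of an atom; note `2 ^ idxLen n ≤ n` for `n ≥ 1`. -/
def idxLen (n : ℕ) : ℕ := Nat.log 2 n

/-- Number of bits of a block. -/
def blockLen (n : ℕ) : ℕ := idxLen n + 3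

/-- Number of blocks of a string of length `n`. -/
def numBlocks (n : ℕ) : ℕ := n / blockLen n

/-- Symbols. -/
inductive Token : Type
  | blank : Token
  | var (i : ℕ) : Token
  | fls : Token
  | tru : Token
  | neg : Token
  | and : Token
  | or : Token
  | imp : Token

/-- The symbol given by three selecting bits and an index. -/
def Token.ofBits : Bool → Bool → Bool → ℕ → Token
  | false, false, false, _ => .blank
  | false, false, true, i => .var i
  | false, true, false, _ => .fls
  | false, true, true, _ => .tru
  | true, false, false, _ => .neg
  | true, false, true, _ => .and
  | true, true, false, _ => .or
  | true, true, true, _ => .imp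

/-- The index written in block `t` (least significant bit first). -/
def blockIdx {n : ℕ} (x : Fin n → Bool) (t : ℕ) : ℕ :=
  ∑ j ∈ Finset.range (idxLen n), if bit x (t * blockLen n + 3 + j) then 2 ^ j else 0

/-- The symbol in block `t`. -/
def token {n : ℕ} (x : Fin n → Bool) (t : ℕ) : Token :=
  Token.ofBits (bit x (t * blockLen n)) (bit x (t * blockLen n + 1))
    (bit x (t * blockLen n + 2)) (blockIdx x t)

/-- One step of parsing reverse Polish notation with a stack of formulas. -/
def parseStep : List (PForm ℕ) → Token → Option (List (PForm ℕ))
  | S, .blank => some S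
  | S, .var i => some (.var i :: S)
  | S, .fls => some (.fls :: S)
  | S, .tru => some (.tru :: S)
  | A :: S, .neg => some (.neg A :: S)
  | B :: A :: S, .and => some (.and A B :: S)
  | B :: A :: S, .or => some (.or A B :: S)
  | B :: A :: S, .imp => some (.imp A B :: S)
  | _, _ => none

/-- The formula encoded by an `n`-bit string, if there is one. -/
def decode {n : ℕ} (x : Fin n → Bool) : Option (PForm ℕ) :=
  match ((List.range (numBlocks n)).map (token x)).foldlM parseStep [] with
  | some [φ] => some φ
  | _ => none

/-- `SAT_n(x, y)`: the `n`-bit string `x` encodes a formula satisfied by the assignment `y`. -/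
def Sat {n : ℕ} (x y : Fin n → Bool) : Prop :=
  ∃ φ : PForm ℕ, decode x = some φ ∧ φ.eval (bit y) = true

/-- `SAT_n(x) = 1`: the string `x` encodes a satisfiable formula. -/
def Satisfiable {n : ℕ} (x : Fin n → Bool) : Prop := ∃ y : Fin n → Bool, Sat x y

/-- `C` has the value `SAT_n(x)` on `x` (first output bit). -/
def AgreesAt {n : ℕ} (C : Circuit) (x : Fin n → Bool) : Prop :=
  C.outBit x 0 = true ↔ Satisfiable x

/-- `C(x) = SAT_n(x)` for all `x ∈ {0,1}^n`. -/
def ComputesSat (n : ℕ) (C : Circuit) : Prop := ∀ x : Fin n → Bool, AgreesAt C x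

/-- `SAT_n ∈ Circuit[s]`. -/
def SatInCircuit (n s : ℕ) : Prop := ∃ C : Circuit, IsCircuit n s C ∧ ComputesSat n C

/-! ## The formulas `α_n^s` -/

/-- Atoms of `α_n^s`. -/
inductive AVar (n : ℕ) : Type
  /-- The bits of the string `x`. -/
  | x (i : ℕ) : AVar n
  /-- The bits of the string `y`. -/
  | y (i : ℕ) : AVar n
  /-- Evaluation of an encoded formula (two copies): no error before step `t`. -/
  | ok (copy : Bool) (t : ℕ) : AVar n
  /-- Evaluation of an encoded formula: before step `t`, the stack has more than `j` entries. -/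
  | occ (copy : Bool) (t j : ℕ) : AVar n
  /-- Evaluation of an encoded formula: value of stack entry `j` before step `t` (`0` = top). -/
  | val (copy : Bool) (t j : ℕ) : AVar n
  /-- The values of the gates of `B` on `x`. -/
  | w (g : ℕ) : AVar n
  /-- Description of `C`: the Boolean function computed by gate `g`. -/
  | op (g : ℕ) (p q : Bool) : AVar n
  /-- Description of `C`: the left argument of gate `g` is wire `j`. -/
  | left (g j : ℕ) : AVar n
  /-- Description of `C`: the right argument of gate `g` is wire `j`. -/
  | right (g j : ℕ) : AVar n
  /-- Description of `C`: the output is wire `j`. -/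
  | out (j : ℕ) : AVar n
  /-- The values of the gates of `C` on the string `z`. -/
  | v (z : Fin n → Bool) (g : ℕ) : AVar n

section SatFormula

/-! The computation of the predicate `SAT_n(x, y)`, where the bits of `y` are given by formulas
`Y`: the reverse Polish notation is evaluated with a stack of truth values. -/

variable {n : ℕ}

/-- The symbol in block `t` has the selecting bits `a, b, c`. -/
def kindF (a b c : Bool) (t : ℕ) : PForm (AVar n) :=
  and (lit a (var (.x (t * blockLen n))))
    (and (lit b (var (.x (t * blockLen n + 1)))) (lit c (var (.x (t * blockLen n + 2)))))

/-- The symbol in block `t` is a constant or an atom. -/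
def isPushF (t : ℕ) : PForm (AVar n) :=
  disj [kindF false false true t, kindF false true false t, kindF false true true t]

/-- The symbol in block `t` is a binary connective. -/
def isBinF (t : ℕ) : PForm (AVar n) :=
  disj [kindF true false true t, kindF true true false t, kindF true true true t]

/-- The value under `Y` of the atom whose index is written in block `t`. -/
def lookupF (Y : ℕ → PForm (AVar n)) (t : ℕ) : PForm (AVar n) :=
  disj ((List.range (2 ^ idxLen n)).map fun i =>
    and (conj ((List.range (idxLen n)).map fun j =>
      lit (i.testBit j) (var (.x (t * blockLen n + 3 + j))))) (Y i))

/-- No error before step `t`. -/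
def okF (c : Bool) (t : ℕ) : PForm (AVar n) := if t = 0 then tru else var (.ok c t)

/-- Entry `j` of the stack exists before step `t`. -/
def occF (c : Bool) (t j : ℕ) : PForm (AVar n) :=
  if t = 0 ∨ numBlocks n < j then fls else var (.occ c t j)

/-- Value of entry `j` of the stack before step `t`. -/
def valF (c : Bool) (t j : ℕ) : PForm (AVar n) :=
  if t = 0 ∨ numBlocks n < j then fls else var (.val c t j)

/-- The new `ok` after reading block `t`: connectives need enough arguments. -/
def okNextF (c : Bool) (t : ℕ) : PForm (AVar n) :=
  conj [okF c t, imp (kindF true false false t) (occF c t 0), imp (isBinF t) (occF c t 1)]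

/-- The new `occ j` after reading block `t`. -/
def occNextF (c : Bool) (t j : ℕ) : PForm (AVar n) :=
  disj [and (kindF false false false t) (occF c t j),
    and (isPushF t) (if j = 0 then tru else occF c t (j - 1)),
    and (kindF true false false t) (occF c t j),
    and (isBinF t) (if j = 0 then tru else occF c t (j + 1))]

/-- The value of a constant or an atom in block `t`. -/
def pushValF (Y : ℕ → PForm (AVar n)) (t : ℕ) : PForm (AVar n) :=
  or (and (kindF false false true t) (lookupF Y t)) (kindF false true true t)

/-- The value of a binary connective in block `t` applied to the two topmost entries. -/
def binValF (c : Bool) (t : ℕ) : PForm (AVar n) :=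
  disj [and (kindF true false true t) (and (valF c t 1) (valF c t 0)),
    and (kindF true true false t) (or (valF c t 1) (valF c t 0)),
    and (kindF true true true t) (imp (valF c t 1) (valF c t 0))]

/-- The new `val j` after reading block `t`. -/
def valNextF (c : Bool) (Y : ℕ → PForm (AVar n)) (t j : ℕ) : PForm (AVar n) :=
  disj [and (kindF false false false t) (valF c t j),
    and (isPushF t) (if j = 0 then pushValF Y t else valF c t (j - 1)),
    and (kindF true false false t) (if j = 0 then neg (valF c t 0) else valF c t j),
    and (isBinF t) (if j = 0 then binValF c t else valF c t (j + 1))]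

/-- The auxiliary atoms of copy `c` carry the computation of `SAT_n(x, Y)`. -/
def satCompF (c : Bool) (Y : ℕ → PForm (AVar n)) : PForm (AVar n) :=
  conj ((List.range (numBlocks n)).map fun t =>
    and (iff (okF c (t + 1)) (okNextF c t))
      (conj ((List.range (numBlocks n + 1)).map fun j =>
        and (iff (occF c (t + 1) j) (occNextF c t j))
          (iff (valF c (t + 1) j) (valNextF c Y t j)))))

/-- The result of the computation of copy `c`: parsing ended without error, with exactly one
formula, and its value is `1`. -/
def satOutF (c : Bool) : PForm (AVar n) :=
  conj [okF c (numBlocks n), occF c (numBlocks n) 0, neg (occF c (numBlocks n) 1),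
    valF c (numBlocks n) 0]

end SatFormula

section CircuitFormula

variable {n : ℕ}

/-- Value of a gate with truth table `f` and arguments `a`, `b`. -/
def gateF {V : Type} (f : Bool → Bool → PForm V) (a b : PForm V) : PForm V :=
  disj [and (f false false) (and (neg a) (neg b)), and (f false true) (and (neg a) b),
    and (f true false) (and a (neg b)), and (f true true) (and a b)]

/-- Wire `j` of `B` on input `x`. -/
def wireBF (j : ℕ) : PForm (AVar n) := if j < n then var (.x j) else var (.w (j - n))

/-- The atoms `w` carry the computation of `B(x)`. -/
def compBF (B : Circuit) : PForm (AVar n) :=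
  conj (List.ofFn fun g : Fin B.gates.length =>
    iff (var (.w g)) (gateF (fun p q => const ((B.gates[g]).op p q))
      (wireBF (B.gates[g]).left) (wireBF (B.gates[g]).right)))

/-- The `i`-th output bit of `B(x)`. -/
def outBF (B : Circuit) (i : ℕ) : PForm (AVar n) := (B.outs.map wireBF).getD i fls

/-- Exactly one of `f 0, …, f (m - 1)` is true. -/
def exactlyOneF (m : ℕ) (f : ℕ → PForm (AVar n)) : PForm (AVar n) :=
  and (disj ((List.range m).map f))
    (conj ((List.range m).map fun i =>
      conj ((List.range i).map fun j => neg (and (f i) (f j)))))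

/-- The wire among `0, …, m - 1` selected by `f`. -/
def selectF (m : ℕ) (f wire : ℕ → PForm (AVar n)) : PForm (AVar n) :=
  disj ((List.range m).map fun j => and (f j) (wire j))

/-- The atoms describing `C` are a description of a circuit with `n` inputs and `s` gates. -/
def isCircuitF (s : ℕ) : PForm (AVar n) :=
  and (conj ((List.range s).map fun g =>
      and (exactlyOneF (n + g) fun j => var (.left g j))
        (exactlyOneF (n + g) fun j => var (.right g j))))
    (exactlyOneF (n + s) fun j => var (.out j))

/-- Wire `j` of `C` on input `z`. -/
def wireCF (z : Fin n → Bool) (j : ℕ) : PForm (AVar n) :=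
  if j < n then const (bit z j) else var (.v z (j - n))

/-- The atoms `v z` carry the computation of `C(z)`. -/
def compCF (s : ℕ) (z : Fin n → Bool) : PForm (AVar n) :=
  conj ((List.range s).map fun g =>
    iff (var (.v z g)) (gateF (fun p q => var (.op g p q))
      (selectF (n + g) (fun j => var (.left g j)) (wireCF z))
      (selectF (n + g) (fun j => var (.right g j)) (wireCF z))))

/-- The output `C(z)`. -/
def outCF (s : ℕ) (z : Fin n → Bool) : PForm (AVar n) :=
  selectF (n + s) (fun j => var (.out j)) (wireCF z)

end CircuitFormula

open Classical in
/-- The formula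
`α_n^s = (SAT_n(x,y) → SAT_n(x,B(x))) ∨ ⋁_{z ∈ A} C(z) ≠ SAT_n(z)`,
where `SAT_n(z)` is a hard-wired bit. -/
noncomputable def alpha (n s : ℕ) (A : Finset (Fin n → Bool)) (B : Circuit) : PForm (AVar n) :=
  or
    (imp (conj [satCompF false fun i => var (.y i), compBF B, satCompF true (outBF B)])
      (imp (satOutF false) (satOutF true)))
    (imp (isCircuitF s)
      (disj (A.toList.map fun z =>
        imp (compCF s z) (neg (iff (outCF s z) (const (decide (Satisfiable z))))))))

/-- No circuit of size at most `s` computes `SAT_n` on `A`. -/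
def IsAntichecker (n s : ℕ) (A : Finset (Fin n → Bool)) : Prop :=
  ∀ C : Circuit, IsCircuit n s C → ∃ z ∈ A, ¬ AgreesAt C z

/-- `B` is a circuit with `n` inputs and at most `n` outputs that solves the search version of
`SAT_n`. -/
def SolvesSearch (n : ℕ) (B : Circuit) : Prop :=
  ∀ x y : Fin n → Bool, Sat x y → Sat x (fun i : Fin n => B.outBit x i)

/-- `A`, `B'`, `B` are parameters as used in the definition of `α_n^s`, with size bounds
`s ^ c + c`. -/
structure IsAlphaChoice (n s c : ℕ) (A : Finset (Fin n → Bool)) (B' B : Circuit) : Prop where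
  /-- `A` has polynomial size. -/
  card_A : A.card ≤ s ^ c + c
  /-- `A` is a set of anticheckers of `SAT_n` w.r.t. `s` if `SAT_n ∉ Circuit[s^3]`, and
  arbitrary otherwise. -/
  antichecker : ¬ SatInCircuit n (s ^ 3) → IsAntichecker n s A
  /-- `B'` is a single-output circuit of size at most `s^3`. -/
  circuit_B' : IsCircuit n (s ^ 3) B'
  /-- `B'` computes `SAT_n` iff `SAT_n ∈ Circuit[s^3]`. -/
  computes_B' : SatInCircuit n (s ^ 3) ↔ ComputesSat n B'
  /-- `B` is a circuit with `n` inputs, -/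
  wellFormed_B : B.WellFormed n
  /-- at most `n` outputs, -/
  outs_B : B.outs.length ≤ n
  /-- and polynomial size, -/
  size_B : B.size ≤ s ^ c + c
  /-- which solves the search version of `SAT_n` if `B'` computes `SAT_n`. -/
  search_B : ComputesSat n B' → SolvesSearch n B

/-- All substitution instances of the formulas `α_n^{s(n)}`, `n ≥ n₀`. -/
def alphaInstances (n₀ : ℕ) (s : ℕ → ℕ) (A : ∀ n : ℕ, Finset (Fin n → Bool))
    (B : ℕ → Circuit) : Set (PForm ℕ) :=
  {ψ | ∃ n : ℕ, n₀ ≤ n ∧ ∃ σ : AVar n → PForm ℕ, ψ = (alpha n (s n) (A n) (B n)).subst σ}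

end EFAlpha

/-!
Suppose that `SAT_n` has circuits of size `n ^ k` for all large `n`. Then every tautology `φ` has a
derivation of polynomial size from a single substitution instance of `alpha n (n ^ k) (A n) (B n)`,
where `n` is quadratic in the size of `φ`; this contradicts the hardness of `T`.

In this instance, the string `x` is the code of `¬φ` (with its atoms renamed to small numbers), the
string `y` consists of the atoms of `φ`, and `C` is a circuit for `SAT_n`, padded to exactly `n ^ k`
gates. The atoms that carry the evaluation of `SAT_n(x, y)` are replaced by the formulas on the
stack of the parser, so that the result of the evaluation is `¬φ` itself; all other atoms are
replaced by the constants that they should carry. As `C` makes no error on `A n`, the disjunct about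
`C` is a false constant, and as `¬φ` is unsatisfiable, so is the conclusion `SAT_n(x, B(x))`. What
remains of the instance is `¬φ → ⊥`.

The calculus verifies this by constant folding. The function `fold` simplifies a formula at its
constants (but keeps `A → ⊥`) and replaces `A → A` by `⊤`; `FoldConst.derivable_iff_fold` derives `A ↔ fold A` with
linearly many lines of linear size, and `fold_alpha_instance` says that the instance folds to the
same formula as `¬φ → ⊥`. Thus no derivation has to be written down for the instance: since both
sides of each equivalence in the computation fold to the same formula, it suffices to compute.
The derivations of the finitely many schemes used in folding come from the completeness of the Frege
calculus (`fregeProves_of_tautology`), as a constant suffices for each of them. Substitution is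
enough to provide the auxiliary values, so extension axioms are not used.
-/

namespace EFAlpha

open PForm

/-! ### Completeness of the Frege calculus -/

/-- Derivability from assumptions in the Frege calculus, without size bounds. -/
inductive FregeProves (Γ : Set (PForm ℕ)) : PForm ℕ → Prop
  | ax {A : PForm ℕ} : FregeAxiom A → FregeProves Γ A
  | hyp {A : PForm ℕ} : A ∈ Γ → FregeProves Γ A
  | mp {A B : PForm ℕ} : FregeProves Γ (imp A B) → FregeProves Γ A → FregeProves Γ B

namespace FregeProves

variable {Γ Δ : Set (PForm ℕ)} {A B C : PForm ℕ}

theorem mono (h : FregeProves Γ A) (hs : Γ ⊆ Δ) : FregeProves Δ A := by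
  induction h with
  | ax h => exact .ax h
  | hyp h => exact .hyp (hs h)
  | mp _ _ ih₁ ih₂ => exact .mp ih₁ ih₂

theorem weaken (h : FregeProves Γ A) : FregeProves Γ (imp B A) := .mp (.ax (.k A B)) h

theorem imp_self (A : PForm ℕ) : FregeProves Γ (imp A A) :=
  .mp (.mp (.ax (.s A (imp A A) A)) (.ax (.k A (imp A A)))) (.ax (.k A A))

/-- The deduction theorem. -/
theorem deduction (h : FregeProves (insert A Γ) B) : FregeProves Γ (imp A B) := by
  induction h with
  | ax h => exact weaken (.ax h)
  | hyp h =>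
    rcases h with rfl | h
    · exact imp_self _
    · exact weaken (.hyp h)
  | mp _ _ ih₁ ih₂ => exact .mp (.mp (.ax (.s _ _ _)) ih₁) ih₂

theorem head (A : PForm ℕ) (Γ : Set (PForm ℕ)) : FregeProves (insert A Γ) A :=
  .hyp (Set.mem_insert _ _)

theorem insert_mono (h : FregeProves Γ B) : FregeProves (insert A Γ) B :=
  h.mono (Set.subset_insert _ _)

theorem neg_intro (h : FregeProves (insert A Γ) B) (h' : FregeProves (insert A Γ) (neg B)) :
    FregeProves Γ (neg A) :=
  .mp (.mp (.ax (.negI A B)) h.deduction) h'.deduction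

theorem absurd (h : FregeProves Γ A) (h' : FregeProves Γ (neg A)) : FregeProves Γ B :=
  .mp (.ax (.negE B)) (neg_intro h.insert_mono h'.insert_mono)

theorem by_cases (h : FregeProves (insert A Γ) B) (h' : FregeProves (insert (neg A) Γ) B) :
    FregeProves Γ B := by
  have h₁ : FregeProves (insert (neg B) Γ) (neg A) :=
    .mp (.mp (.ax (.negI A B)) h.deduction.insert_mono) (weaken (head _ _))
  exact .mp (.ax (.negE B)) (neg_intro (.mp h'.deduction.insert_mono h₁) (head _ _))

/-- Kalmár's lemma: the truth value of a formula is derivable from the truth values of its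
atoms. -/
theorem lit_eval (a : ℕ → Bool) :
    ∀ ψ : PForm ℕ, (∀ v ∈ ψ.vars, FregeProves Γ (lit (a v) (var v))) →
      FregeProves Γ (lit (ψ.eval a) ψ) := by
  intro ψ
  induction ψ with
  | var v => intro h; exact h v (by simp [vars])
  | tru => intro _; exact .ax .truI
  | fls =>
    intro _
    exact neg_intro (.mp (.ax (.flsE tru)) (head _ _))
      (.mp (.ax (.flsE (neg tru))) (head _ _))
  | neg A ih =>
    intro h
    have hA := ih h
    cases hv : A.eval a <;> simp only [hv, eval, lit, Bool.not_true, Bool.not_false, if_true,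
      Bool.false_eq_true, if_false] at hA ⊢
    · exact hA
    · exact neg_intro hA.insert_mono (head _ _)
  | and A B ihA ihB =>
    intro h
    have hA := ihA fun v hv => h v (Or.inl hv)
    have hB := ihB fun v hv => h v (Or.inr hv)
    cases hv : A.eval a <;> cases hw : B.eval a <;> simp only [hv, hw, eval, lit, Bool.and_self,
      Bool.and_true, Bool.and_false, if_true, Bool.false_eq_true, if_false]
      at hA hB ⊢
    · exact neg_intro (.mp (.ax (.andL A B)) (head _ _)) hA.insert_mono
    · exact neg_intro (.mp (.ax (.andL A B)) (head _ _)) hA.insert_mono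
    · exact neg_intro (.mp (.ax (.andR A B)) (head _ _)) hB.insert_mono
    · exact .mp (.mp (.ax (.andI A B)) hA) hB
  | or A B ihA ihB =>
    intro h
    have hA := ihA fun v hv => h v (Or.inl hv)
    have hB := ihB fun v hv => h v (Or.inr hv)
    cases hv : A.eval a <;> cases hw : B.eval a <;> simp only [hv, hw, eval, lit, Bool.or_self,
      Bool.or_true, Bool.or_false, if_true, Bool.false_eq_true,
      if_false] at hA hB ⊢
    · refine neg_intro (B := A) ?_ hA.insert_mono
      exact .mp (.mp (.mp (.ax (.orE A B A)) (imp_self A))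
        (deduction (absurd (head _ _) hB.insert_mono.insert_mono))) (head _ _)
    · exact .mp (.ax (.orR A B)) hB
    · exact .mp (.ax (.orL A B)) hA
    · exact .mp (.ax (.orL A B)) hA
  | imp A B ihA ihB =>
    intro h
    have hA := ihA fun v hv => h v (Or.inl hv)
    have hB := ihB fun v hv => h v (Or.inr hv)
    cases hv : A.eval a <;> cases hw : B.eval a <;> simp only [hv, hw, eval, lit, Bool.or_self,
      Bool.not_true, Bool.not_false, Bool.or_true, Bool.or_false,
      if_true, Bool.false_eq_true, if_false] at hA hB ⊢
    · exact deduction (absurd (head _ _) hA.insert_mono)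
    · exact weaken hB
    · exact neg_intro (.mp (head _ _) hA.insert_mono) hB.insert_mono
    · exact weaken hB

end FregeProves

theorem exists_vars_lt (ψ : PForm ℕ) : ∃ k, ∀ v ∈ ψ.vars, v < k := by
  induction ψ with
  | var v => exact ⟨v + 1, by simp [vars]⟩
  | tru => exact ⟨0, by simp [vars]⟩
  | fls => exact ⟨0, by simp [vars]⟩
  | neg A ih => exact ih
  | and A B ihA ihB | or A B ihA ihB | imp A B ihA ihB =>
    obtain ⟨k, hk⟩ := ihA
    obtain ⟨l, hl⟩ := ihB
    exact ⟨max k l, fun v hv => hv.elim (fun h => lt_max_of_lt_left (hk v h))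
      fun h => lt_max_of_lt_right (hl v h)⟩

/-- Completeness of the Frege calculus; the atoms are eliminated from Kalmár's lemma one at a
time by case distinction. -/
theorem fregeProves_of_tautology {ψ : PForm ℕ} (h : ψ.Tautology) : FregeProves ∅ ψ := by
  obtain ⟨k, hk⟩ := exists_vars_lt ψ
  have key : ∀ d ≤ k, ∀ a : ℕ → Bool,
      FregeProves {A | ∃ i < k - d, A = lit (a i) (var i)} ψ := by
    intro d
    induction d with
    | zero =>
      intro _ a
      have := FregeProves.lit_eval (Γ := {A | ∃ i < k, A = lit (a i) (var i)}) a ψ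
        fun v hv => .hyp ⟨v, hk v hv, rfl⟩
      rwa [h a] at this
    | succ d ih =>
      intro hd a
      have key : ∀ b, {A | ∃ i < k - d, A = lit (Function.update a (k - (d + 1)) b i) (var i)} ⊆
          insert (lit b (var (k - (d + 1)))) {A | ∃ i < k - (d + 1), A = lit (a i) (var i)} := by
        rintro b A ⟨i, hi, rfl⟩
        by_cases hi' : i = k - (d + 1)
        · subst hi'
          exact Or.inl (by rw [Function.update_self])
        · exact Or.inr ⟨i, by omega, by rw [Function.update_of_ne hi']⟩
      exact FregeProves.by_cases ((ih (by omega) _).mono (key true))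
        ((ih (by omega) _).mono (key false))
  exact (key k le_rfl fun _ => false).mono (by rintro A ⟨i, hi, -⟩; omega)

/-! ### Size-bounded derivations -/

theorem PForm.one_le_size {V : Type} (A : PForm V) : 1 ≤ A.size := by
  cases A <;> simp [size]

theorem PForm.size_subst_le {V W : Type} {σ : V → PForm W} {S : ℕ} (hS : 1 ≤ S)
    (h : ∀ v, (σ v).size ≤ S) (A : PForm V) : (A.subst σ).size ≤ A.size * S := by
  induction A with
  | var v => simpa [subst, size] using h v
  | tru => simpa [subst, size] using hS
  | fls => simpa [subst, size] using hS
  | neg A ih => simp only [subst, size]; nlinarith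
  | and A B ihA ihB | or A B ihA ihB | imp A B ihA ihB => simp only [subst, size]; nlinarith

theorem FregeAxiom.subst {A : PForm ℕ} (h : FregeAxiom A) (σ : ℕ → PForm ℕ) :
    FregeAxiom (A.subst σ) := by
  cases h <;> simp only [PForm.subst] <;> constructor

/-- `A` has a derivation from `H` without extension axioms, with at most `L` lines, each of size
at most `M`. -/
def Derivable (H : Set (PForm ℕ)) (M L : ℕ) (A : PForm ℕ) : Prop :=
  ∃ Γ : List (PForm ℕ), EFLines H [] (A :: Γ) ∧ (A :: Γ).length ≤ L ∧ ∀ B ∈ A :: Γ, B.size ≤ M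

theorem EFLines.append {H : Set (PForm ℕ)} {Γ Δ : List (PForm ℕ)} (h : EFLines H [] Γ)
    (h' : EFLines H [] Δ) : EFLines H [] (Γ ++ Δ) := by
  generalize hE : ([] : List ℕ) = E at h
  induction h with
  | nil => exact h'
  | ax _ hA ih => exact .ax (ih hE) hA
  | hyp _ hA ih => exact .hyp (ih hE) hA
  | mp _ hA hB ih => exact .mp (ih hE) (List.mem_append_left _ hA) (List.mem_append_left _ hB)
  | ext => cases hE

namespace Derivable

variable {H : Set (PForm ℕ)} {M M' L L' : ℕ} {A B : PForm ℕ}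

theorem mono (h : Derivable H M L A) (hM : M ≤ M') (hL : L ≤ L') : Derivable H M' L' A := by
  obtain ⟨Γ, h₁, h₂, h₃⟩ := h
  exact ⟨Γ, h₁, h₂.trans hL, fun B hB => (h₃ B hB).trans hM⟩

theorem ax (h : FregeAxiom A) (hM : A.size ≤ M) : Derivable H M 1 A :=
  ⟨[], .ax .nil h, by simp, by simpa using hM⟩

theorem hyp (h : A ∈ H) (hM : A.size ≤ M) : Derivable H M 1 A :=
  ⟨[], .hyp .nil h, by simp, by simpa using hM⟩

theorem mp (h : Derivable H M L (imp A B)) (h' : Derivable H M L' A) :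
    Derivable H M (L + L' + 1) B := by
  obtain ⟨Γ, h₁, h₂, h₃⟩ := h
  obtain ⟨Δ, h₁', h₂', h₃'⟩ := h'
  refine ⟨imp A B :: Γ ++ A :: Δ, .mp (h₁.append h₁') (by simp) (List.mem_cons_self ..), ?_, ?_⟩
  · simp only [List.length_cons, List.length_append] at h₂ h₂' ⊢; omega
  · have hB : B.size ≤ M := by
      have := h₃ (imp A B) (List.mem_cons_self ..)
      simp only [size] at this; omega
    intro C hC
    rcases List.mem_cons.1 hC with rfl | hC
    · exact hB
    · exact (List.mem_append.1 hC).elim (h₃ C) (h₃' C)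

theorem efDerivable (h : Derivable H M L A) : EFDerivable H A (L * M) := by
  obtain ⟨Γ, h₁, h₂, h₃⟩ := h
  refine ⟨[], Γ, h₁, by simp, ?_⟩
  calc ((A :: Γ).map PForm.size).sum ≤ ((A :: Γ).map PForm.size).length • M :=
        List.sum_le_card_nsmul _ _ (by simpa using h₃)
    _ ≤ L * M := by
        rw [smul_eq_mul, List.length_map]; exact Nat.mul_le_mul_right _ h₂

end Derivable

/-- Substitution instances of a fixed tautology have derivations with a constant number of lines,
of size linear in the substituted formulas. -/
theorem PForm.Tautology.exists_derivable_subst {ψ : PForm ℕ} (h : ψ.Tautology) :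
    ∃ K, ∀ (H : Set (PForm ℕ)) (S : ℕ) (σ : ℕ → PForm ℕ), (∀ i, (σ i).size ≤ S) →
      Derivable H (K * S) K (ψ.subst σ) := by
  have := fregeProves_of_tautology h
  clear h
  induction this with
  | @ax A hA =>
    refine ⟨A.size, fun H S σ hσ => ?_⟩
    exact (Derivable.ax (hA.subst σ)
      (PForm.size_subst_le ((PForm.one_le_size (σ 0)).trans (hσ 0)) hσ A)).mono le_rfl
      A.one_le_size
  | hyp h => exact h.elim
  | mp _ _ ih₁ ih₂ =>
    obtain ⟨K, hK⟩ := ih₁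
    obtain ⟨K', hK'⟩ := ih₂
    refine ⟨K + K' + 1, fun H S σ hσ => ?_⟩
    exact ((hK H S σ hσ).mono (by gcongr; omega) le_rfl).mp
      ((hK' H S σ hσ).mono (by gcongr; omega) le_rfl)

/-- The substitution of four formulas for the atoms `0, 1, 2, 3`. -/
def subst₄ (A B C D : PForm ℕ) : ℕ → PForm ℕ
  | 0 => A
  | 1 => B
  | 2 => C
  | _ => D

theorem exists_derivable_subst₄ (Ψ : List (PForm ℕ)) (h : ∀ ψ ∈ Ψ, ψ.Tautology) :
    ∃ K, ∀ ψ ∈ Ψ, ∀ (H : Set (PForm ℕ)) (S : ℕ) (A B C D : PForm ℕ), A.size ≤ S → B.size ≤ S →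
      C.size ≤ S → D.size ≤ S → Derivable H (K * S) K (ψ.subst (subst₄ A B C D)) := by
  induction Ψ with
  | nil => exact ⟨0, by simp⟩
  | cons ψ Ψ ih =>
    obtain ⟨K, hK⟩ := ih fun χ hχ => h χ (List.mem_cons_of_mem _ hχ)
    obtain ⟨K', hK'⟩ := (h ψ (List.mem_cons_self ..)).exists_derivable_subst
    refine ⟨K + K', fun χ hχ H S A B C D hA hB hC hD => ?_⟩
    rcases List.mem_cons.1 hχ with rfl | hχ
    · refine (hK' H S _ ?_).mono (by gcongr; omega) (by omega)
      rintro (_ | _ | _ | i) <;> assumption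
    · exact (hK χ hχ H S A B C D hA hB hC hD).mono (by gcongr; omega) (by omega)

/-! ### Constant folding -/

open Classical in
/-- Negation, simplified on constants. -/
noncomputable def sNeg (A : PForm ℕ) : PForm ℕ :=
  if A = tru then fls else if A = fls then tru else neg A

open Classical in
/-- Conjunction, simplified if one side is a constant. -/
noncomputable def sAnd (A B : PForm ℕ) : PForm ℕ :=
  if A = fls ∨ B = fls then fls else if A = tru then B else if B = tru then A else and A B

open Classical in
/-- Disjunction, simplified if one side is a constant. -/
noncomputable def sOr (A B : PForm ℕ) : PForm ℕ :=
  if A = tru ∨ B = tru then tru else if A = fls then B else if B = fls then A else or A B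

open Classical in
/-- Implication, simplified in some cases with a constant, and if both sides are the same formula.
The latter makes `A ↔ A` simplify to `⊤`. -/
noncomputable def sImp (A B : PForm ℕ) : PForm ℕ :=
  if A = fls ∨ B = tru ∨ A = B then tru else if A = tru then B else imp A B

section simplification

variable (A : PForm ℕ)

@[simp] theorem sNeg_tru : sNeg tru = fls := by simp [sNeg]
@[simp] theorem sNeg_fls : sNeg fls = tru := by simp [sNeg]
@[simp] theorem sAnd_tru_left : sAnd tru A = A := by simp +contextual [sAnd, eq_comm]
@[simp] theorem sAnd_tru_right : sAnd A tru = A := by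
  unfold sAnd; split_ifs <;> simp_all
@[simp] theorem sAnd_fls_left : sAnd fls A = fls := by simp [sAnd]
@[simp] theorem sAnd_fls_right : sAnd A fls = fls := by simp [sAnd]
@[simp] theorem sOr_tru_left : sOr tru A = tru := by simp [sOr]
@[simp] theorem sOr_tru_right : sOr A tru = tru := by simp [sOr]
@[simp] theorem sOr_fls_left : sOr fls A = A := by simp +contextual [sOr, eq_comm]
@[simp] theorem sOr_fls_right : sOr A fls = A := by
  unfold sOr; split_ifs <;> simp_all
@[simp] theorem sImp_tru_left : sImp tru A = A := by simp +contextual [sImp, eq_comm]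
@[simp] theorem sImp_tru_right : sImp A tru = tru := by simp [sImp]
@[simp] theorem sImp_fls_left : sImp fls A = tru := by simp [sImp]
@[simp] theorem sImp_self : sImp A A = tru := by simp [sImp]

end simplification

/-- Constant folding of a formula. -/
noncomputable def fold : PForm ℕ → PForm ℕ
  | var v => var v
  | tru => tru
  | fls => fls
  | neg A => sNeg (fold A)
  | PForm.and A B => sAnd (fold A) (fold B)
  | PForm.or A B => sOr (fold A) (fold B)
  | imp A B => sImp (fold A) (fold B)

theorem size_sNeg_le (A : PForm ℕ) : (sNeg A).size ≤ A.size + 1 := by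
  unfold sNeg; split_ifs <;> (try simp only [size]) <;> omega

theorem size_sAnd_le (A B : PForm ℕ) : (sAnd A B).size ≤ A.size + B.size + 1 := by
  unfold sAnd; split_ifs <;> (try simp only [size]) <;> omega

theorem size_sOr_le (A B : PForm ℕ) : (sOr A B).size ≤ A.size + B.size + 1 := by
  unfold sOr; split_ifs <;> (try simp only [size]) <;> omega

theorem size_sImp_le (A B : PForm ℕ) : (sImp A B).size ≤ A.size + B.size + 1 := by
  unfold sImp; split_ifs <;> (try simp only [size]) <;> omega

theorem size_fold_le (A : PForm ℕ) : (fold A).size ≤ A.size := by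
  induction A with
  | var v => simp [fold]
  | tru => simp [fold]
  | fls => simp [fold]
  | neg A ih => exact (size_sNeg_le _).trans (by simp only [size]; omega)
  | and A B ihA ihB => exact (size_sAnd_le _ _).trans (by simp only [size]; omega)
  | or A B ihA ihB => exact (size_sOr_le _ _).trans (by simp only [size]; omega)
  | imp A B ihA ihB => exact (size_sImp_le _ _).trans (by simp only [size]; omega)

/-- The tautologies used in deriving `A ↔ fold A`: reflexivity and transitivity of `↔`,
congruence, the simplifications, and the inferences that conclude the derivation. -/
def foldSchemes : List (PForm ℕ) :=
  let p : PForm ℕ := var 0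
  let q : PForm ℕ := var 1
  let r : PForm ℕ := var 2
  let s : PForm ℕ := var 3
  [iff p p, imp (iff p q) (imp (iff q r) (iff p r)),
    imp (iff p q) (iff (neg p) (neg q)),
    imp (iff p q) (imp (iff r s) (iff (and p r) (and q s))),
    imp (iff p q) (imp (iff r s) (iff (or p r) (or q s))),
    imp (iff p q) (imp (iff r s) (iff (imp p r) (imp q s))),
    iff (neg tru) fls, iff (neg fls) tru,
    iff (and fls p) fls, iff (and p fls) fls, iff (and tru p) p, iff (and p tru) p,
    iff (or tru p) tru, iff (or p tru) tru, iff (or fls p) p, iff (or p fls) p,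
    iff (imp fls p) tru, iff (imp p tru) tru, iff (imp p p) tru, iff (imp tru p) p,
    imp (iff p r) (imp (iff (imp (neg q) fls) r) (imp p q))]

theorem tautology_of_mem_foldSchemes : ∀ ψ ∈ foldSchemes, ψ.Tautology := by
  intro ψ hψ a
  simp only [foldSchemes, List.mem_cons, List.not_mem_nil, or_false] at hψ
  rcases hψ with rfl | rfl | rfl | rfl | rfl | rfl | rfl | rfl | rfl | rfl | rfl | rfl | rfl | rfl |
    rfl | rfl | rfl | rfl | rfl | rfl | rfl <;> simp only [eval, iff] <;> cases a 0 <;>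
    cases a 1 <;> cases a 2 <;> cases a 3 <;> rfl

/-- `K` bounds the lines and the relative size of derivations of instances of `foldSchemes`. -/
def FoldConst (K : ℕ) : Prop :=
  ∀ ψ ∈ foldSchemes, ∀ (H : Set (PForm ℕ)) (S : ℕ) (A B C D : PForm ℕ), A.size ≤ S → B.size ≤ S →
    C.size ≤ S → D.size ≤ S → Derivable H (K * S) K (ψ.subst (subst₄ A B C D))

theorem exists_foldConst : ∃ K, FoldConst K :=
  exists_derivable_subst₄ _ tautology_of_mem_foldSchemes

namespace FoldConst

variable {K : ℕ} {H : Set (PForm ℕ)} {M S L L' : ℕ} {A A' B B' C : PForm ℕ}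

theorem refl (hK : FoldConst K) (hM : K * S ≤ M) (hA : A.size ≤ S) :
    Derivable H M K (iff A A) :=
  (hK (iff (var 0) (var 0)) (by simp [foldSchemes]) H S A A A A hA hA hA hA).mono hM le_rfl

theorem trans (hK : FoldConst K) (hM : K * S ≤ M) (hA : A.size ≤ S) (hB : B.size ≤ S)
    (hC : C.size ≤ S) (h : Derivable H M L (iff A B)) (h' : Derivable H M L' (iff B C)) :
    Derivable H M (L + L' + K + 2) (iff A C) :=
  ((((hK (imp (iff (var 0) (var 1)) (imp (iff (var 1) (var 2)) (iff (var 0) (var 2))))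
    (by simp [foldSchemes]) H S A B C C hA hB hC hC).mono hM le_rfl).mp h).mp h').mono le_rfl
    (by omega)

theorem neg_congr (hK : FoldConst K) (hM : K * S ≤ M) (hA : A.size ≤ S) (hA' : A'.size ≤ S)
    (h : Derivable H M L (iff A A')) : Derivable H M (L + K + 1) (iff (neg A) (neg A')) :=
  (((hK (imp (iff (var 0) (var 1)) (iff (neg (var 0)) (neg (var 1))))
    (by simp [foldSchemes]) H S A A' A A hA hA' hA hA).mono hM le_rfl).mp h).mono le_rfl
    (by omega)

theorem and_congr (hK : FoldConst K) (hM : K * S ≤ M) (hA : A.size ≤ S) (hA' : A'.size ≤ S)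
    (hB : B.size ≤ S) (hB' : B'.size ≤ S) (h : Derivable H M L (iff A A'))
    (h' : Derivable H M L' (iff B B')) :
    Derivable H M (L + L' + K + 2) (iff (and A B) (and A' B')) :=
  ((((hK (imp (iff (var 0) (var 1)) (imp (iff (var 2) (var 3))
    (iff (and (var 0) (var 2)) (and (var 1) (var 3)))))
    (by simp [foldSchemes]) H S A A' B B' hA hA' hB hB').mono hM le_rfl).mp h).mp h').mono le_rfl
    (by omega)

theorem or_congr (hK : FoldConst K) (hM : K * S ≤ M) (hA : A.size ≤ S) (hA' : A'.size ≤ S)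
    (hB : B.size ≤ S) (hB' : B'.size ≤ S) (h : Derivable H M L (iff A A'))
    (h' : Derivable H M L' (iff B B')) :
    Derivable H M (L + L' + K + 2) (iff (or A B) (or A' B')) :=
  ((((hK (imp (iff (var 0) (var 1)) (imp (iff (var 2) (var 3))
    (iff (or (var 0) (var 2)) (or (var 1) (var 3)))))
    (by simp [foldSchemes]) H S A A' B B' hA hA' hB hB').mono hM le_rfl).mp h).mp h').mono le_rfl
    (by omega)

theorem imp_congr (hK : FoldConst K) (hM : K * S ≤ M) (hA : A.size ≤ S) (hA' : A'.size ≤ S)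
    (hB : B.size ≤ S) (hB' : B'.size ≤ S) (h : Derivable H M L (iff A A'))
    (h' : Derivable H M L' (iff B B')) :
    Derivable H M (L + L' + K + 2) (iff (imp A B) (imp A' B')) :=
  ((((hK (imp (iff (var 0) (var 1)) (imp (iff (var 2) (var 3))
    (iff (imp (var 0) (var 2)) (imp (var 1) (var 3)))))
    (by simp [foldSchemes]) H S A A' B B' hA hA' hB hB').mono hM le_rfl).mp h).mp h').mono le_rfl
    (by omega)

theorem sNeg_iff (hK : FoldConst K) (hM : K * S ≤ M) (hS : (neg A).size ≤ S) :
    Derivable H M K (iff (neg A) (sNeg A)) := by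
  have hA : A.size ≤ S := by simp only [size] at hS; omega
  have key := fun ψ h => (hK ψ h H S A A A A hA hA hA hA).mono hM le_rfl
  unfold sNeg
  split_ifs with h₁ h₂
  · subst h₁; exact key (iff (neg tru) fls) (by simp [foldSchemes])
  · subst h₂; exact key (iff (neg fls) tru) (by simp [foldSchemes])
  · exact hK.refl hM hS

theorem sAnd_iff (hK : FoldConst K) (hM : K * S ≤ M) (hS : (and A B).size ≤ S) :
    Derivable H M K (iff (and A B) (sAnd A B)) := by
  have hA : A.size ≤ S := by simp only [size] at hS; omega
  have hB : B.size ≤ S := by simp only [size] at hS; omega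
  have keyA := fun ψ h => (hK ψ h H S A A A A hA hA hA hA).mono hM le_rfl
  have keyB := fun ψ h => (hK ψ h H S B B B B hB hB hB hB).mono hM le_rfl
  unfold sAnd
  split_ifs with h₁ h₂ h₃
  · rcases h₁ with rfl | rfl
    · exact keyB (iff (and fls (var 0)) fls) (by simp [foldSchemes])
    · exact keyA (iff (and (var 0) fls) fls) (by simp [foldSchemes])
  · subst h₂; exact keyB (iff (and tru (var 0)) (var 0)) (by simp [foldSchemes])
  · subst h₃; exact keyA (iff (and (var 0) tru) (var 0)) (by simp [foldSchemes])
  · exact hK.refl hM hS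

theorem sOr_iff (hK : FoldConst K) (hM : K * S ≤ M) (hS : (or A B).size ≤ S) :
    Derivable H M K (iff (or A B) (sOr A B)) := by
  have hA : A.size ≤ S := by simp only [size] at hS; omega
  have hB : B.size ≤ S := by simp only [size] at hS; omega
  have keyA := fun ψ h => (hK ψ h H S A A A A hA hA hA hA).mono hM le_rfl
  have keyB := fun ψ h => (hK ψ h H S B B B B hB hB hB hB).mono hM le_rfl
  unfold sOr
  split_ifs with h₁ h₂ h₃
  · rcases h₁ with rfl | rfl
    · exact keyB (iff (or tru (var 0)) tru) (by simp [foldSchemes])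
    · exact keyA (iff (or (var 0) tru) tru) (by simp [foldSchemes])
  · subst h₂; exact keyB (iff (or fls (var 0)) (var 0)) (by simp [foldSchemes])
  · subst h₃; exact keyA (iff (or (var 0) fls) (var 0)) (by simp [foldSchemes])
  · exact hK.refl hM hS

theorem sImp_iff (hK : FoldConst K) (hM : K * S ≤ M) (hS : (imp A B).size ≤ S) :
    Derivable H M K (iff (imp A B) (sImp A B)) := by
  have hA : A.size ≤ S := by simp only [size] at hS; omega
  have hB : B.size ≤ S := by simp only [size] at hS; omega
  have keyA := fun ψ h => (hK ψ h H S A A A A hA hA hA hA).mono hM le_rfl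
  have keyB := fun ψ h => (hK ψ h H S B B B B hB hB hB hB).mono hM le_rfl
  unfold sImp
  split_ifs with h₁ h₂
  · rcases h₁ with rfl | rfl | rfl
    · exact keyB (iff (imp fls (var 0)) tru) (by simp [foldSchemes])
    · exact keyA (iff (imp (var 0) tru) tru) (by simp [foldSchemes])
    · exact keyA (iff (imp (var 0) (var 0)) tru) (by simp [foldSchemes])
  · subst h₂; exact keyB (iff (imp tru (var 0)) (var 0)) (by simp [foldSchemes])
  · exact hK.refl hM hS

/-- A formula is provably equivalent to its constant folding, with linearly many lines of linear
size. -/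
theorem derivable_iff_fold (hK : FoldConst K) (A : PForm ℕ) (hM : K * A.size ≤ M) :
    Derivable H M ((3 * K + 4) * A.size) (iff A (fold A)) := by
  have sizeF := size_fold_le
  have mulM {a b : ℕ} (h : a ≤ b) (hM : K * b ≤ M) : K * a ≤ M :=
    (Nat.mul_le_mul_left K h).trans hM
  induction A with
  | var v => exact (hK.refl hM le_rfl).mono le_rfl (by simp only [size]; omega)
  | tru => exact (hK.refl hM le_rfl).mono le_rfl (by simp only [size]; omega)
  | fls => exact (hK.refl hM le_rfl).mono le_rfl (by simp only [size]; omega)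
  | neg A ih =>
    have h₁ := sizeF A
    have h₂ := sizeF (neg A)
    have ih := ih (mulM (by simp only [size]; omega) hM)
    refine (hK.trans (S := (neg A).size) hM le_rfl (by simp only [size]; omega) h₂
      (hK.neg_congr hM (by simp only [size]; omega) (by simp only [size]; omega) ih)
      (hK.sNeg_iff hM (by simp only [size]; omega))).mono le_rfl ?_
    simp only [size]; nlinarith
  | and A B ihA ihB =>
    have h₁ := sizeF A
    have h₂ := sizeF B
    have h₃ := sizeF (and A B)
    have ihA := ihA (mulM (by simp only [size]; omega) hM)
    have ihB := ihB (mulM (by simp only [size]; omega) hM)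
    refine (hK.trans (S := (and A B).size) hM le_rfl (by simp only [size]; omega) h₃
      (hK.and_congr hM (by simp only [size]; omega) (by simp only [size]; omega)
        (by simp only [size]; omega) (by simp only [size]; omega) ihA ihB)
      (hK.sAnd_iff hM (by simp only [size]; omega))).mono le_rfl ?_
    simp only [size]; nlinarith
  | or A B ihA ihB =>
    have h₁ := sizeF A
    have h₂ := sizeF B
    have h₃ := sizeF (or A B)
    have ihA := ihA (mulM (by simp only [size]; omega) hM)
    have ihB := ihB (mulM (by simp only [size]; omega) hM)
    refine (hK.trans (S := (or A B).size) hM le_rfl (by simp only [size]; omega) h₃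
      (hK.or_congr hM (by simp only [size]; omega) (by simp only [size]; omega)
        (by simp only [size]; omega) (by simp only [size]; omega) ihA ihB)
      (hK.sOr_iff hM (by simp only [size]; omega))).mono le_rfl ?_
    simp only [size]; nlinarith
  | imp A B ihA ihB =>
    have h₁ := sizeF A
    have h₂ := sizeF B
    have h₃ := sizeF (imp A B)
    have ihA := ihA (mulM (by simp only [size]; omega) hM)
    have ihB := ihB (mulM (by simp only [size]; omega) hM)
    refine (hK.trans (S := (imp A B).size) hM le_rfl (by simp only [size]; omega) h₃
      (hK.imp_congr hM (by simp only [size]; omega) (by simp only [size]; omega)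
        (by simp only [size]; omega) (by simp only [size]; omega) ihA ihB)
      (hK.sImp_iff hM (by simp only [size]; omega))).mono le_rfl ?_
    simp only [size]; nlinarith

end FoldConst

/-- If a hypothesis folds to the same formula as `¬φ → ⊥`, then `φ` has a derivation of size
quadratic in the sizes of the hypothesis and of `φ`. -/
theorem exists_efDerivable_of_fold_eq : ∃ K, ∀ (H : Set (PForm ℕ)) (ψ φ : PForm ℕ), ψ ∈ H →
    fold ψ = fold (imp (neg φ) fls) → EFDerivable H φ (K * (ψ.size + φ.size) ^ 2) := by
  obtain ⟨K, hK⟩ := exists_foldConst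
  refine ⟨(7 * K + 20) * (7 * K + 20) * 10, fun H ψ φ hψ h => ?_⟩
  set S := ψ.size + φ.size + 3 with hS
  have hM : K * S ≤ (K + 1) * S := by nlinarith
  have h₁ := hK.derivable_iff_fold (H := H) (M := (K + 1) * S) ψ
    (le_trans (Nat.mul_le_mul_left K (by omega)) hM)
  have h₂ := hK.derivable_iff_fold (H := H) (M := (K + 1) * S) (imp (neg φ) fls)
    (le_trans (Nat.mul_le_mul_left K (by simp only [size]; omega)) hM)
  rw [← h] at h₂
  have h₃ := (hK (imp (iff (var 0) (var 2)) (imp (iff (imp (neg (var 1)) fls) (var 2))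
    (imp (var 0) (var 1)))) (by simp [foldSchemes]) H S ψ φ (fold ψ) ψ (by omega) (by omega)
    ((size_fold_le ψ).trans (by omega)) (by omega)).mono hM le_rfl
  have h₄ := ((h₃.mp h₁).mp h₂).mp (.hyp hψ (show ψ.size ≤ _ by nlinarith))
  obtain ⟨E, Γ, h₅, h₆, h₇⟩ := h₄.efDerivable
  refine ⟨E, Γ, h₅, h₆, h₇.trans ?_⟩
  have hψ1 := ψ.one_le_size
  have hφ1 := φ.one_le_size
  have hS' : S ≤ 3 * (ψ.size + φ.size) := by omega
  have hL : K + (3 * K + 4) * ψ.size + 1 + (3 * K + 4) * (imp (neg φ) fls).size + 1 + 1 + 1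
      ≤ (7 * K + 20) * (3 * (ψ.size + φ.size)) := by
    simp only [size]; nlinarith
  calc
    _ ≤ ((7 * K + 20) * (3 * (ψ.size + φ.size))) * ((7 * K + 20) * (3 * (ψ.size + φ.size))) :=
        Nat.mul_le_mul hL (Nat.mul_le_mul (by omega) hS')
    _ ≤ _ := by nlinarith [sq_nonneg ((7 * K + 20) * (ψ.size + φ.size))]

/-! ### Constant folding of substitution instances -/

section fold_subst

variable {V : Type} (σ : V → PForm ℕ)

theorem const_and (a b : Bool) : sAnd (const a) (const b) = const (a && b) := by
  cases a <;> cases b <;> simp [const]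

theorem const_or (a b : Bool) : sOr (const a) (const b) = const (a || b) := by
  cases a <;> cases b <;> simp [const]

theorem const_neg (a : Bool) : sNeg (const a) = const (!a) := by
  cases a <;> simp [const]

theorem const_imp (a b : Bool) : sImp (const a) (const b) = const (!a || b) := by
  cases a <;> cases b <;> simp [const]

@[simp] theorem fold_const (b : Bool) : fold (const b) = const b := by
  cases b <;> rfl

@[simp] theorem eval_const (a : V → Bool) (b : Bool) : (const b : PForm V).eval a = b := by
  cases b <;> rfl

theorem eval_subst {W : Type} (σ : V → PForm W) (a : W → Bool) (ψ : PForm V) :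
    (ψ.subst σ).eval a = ψ.eval fun v => (σ v).eval a := by
  induction ψ <;> simp_all [PForm.subst, PForm.eval]

/-- A formula folds to its truth value if its atoms fold to constants. -/
theorem fold_subst_eq_const {σ : V → PForm ℕ} {a : V → Bool} (ψ : PForm V)
    (h : ∀ v ∈ ψ.vars, fold (σ v) = const (a v)) : fold (ψ.subst σ) = const (ψ.eval a) := by
  induction ψ with
  | var v => exact h v rfl
  | tru => rfl
  | fls => rfl
  | neg A ih => simp only [PForm.subst, fold, PForm.eval, ih h, const_neg]
  | and A B ihA ihB =>
    simp only [PForm.subst, fold, PForm.eval, ihA fun v hv => h v (Or.inl hv),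
      ihB fun v hv => h v (Or.inr hv), const_and]
  | or A B ihA ihB =>
    simp only [PForm.subst, fold, PForm.eval, ihA fun v hv => h v (Or.inl hv),
      ihB fun v hv => h v (Or.inr hv), const_or]
  | imp A B ihA ihB =>
    simp only [PForm.subst, fold, PForm.eval, ihA fun v hv => h v (Or.inl hv),
      ihB fun v hv => h v (Or.inr hv), const_imp]

theorem fold_subst_conj_eq_tru {L : List (PForm V)} (h : ∀ A ∈ L, fold (A.subst σ) = tru) :
    fold ((conj L).subst σ) = tru := by
  induction L with
  | nil => rfl
  | cons A L ih =>
    have h₁ := h A (List.mem_cons_self ..)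
    have h₂ := ih fun B hB => h B (List.mem_cons_of_mem _ hB)
    simp only [conj, List.foldr_cons, PForm.subst, fold] at h₂ ⊢
    rw [h₁, h₂, sAnd_tru_left]

theorem fold_subst_iff_eq_tru {A B : PForm V} (h : fold (A.subst σ) = fold (B.subst σ)) :
    fold ((iff A B).subst σ) = tru := by
  simp [PForm.iff, PForm.subst, fold, h]

theorem fold_subst_lit {A : PForm V} {a b : Bool} (h : fold (A.subst σ) = const a) :
    fold ((lit b A).subst σ) = const (a == b) := by
  cases b <;> cases a <;> simp [lit, PForm.subst, fold, h, const]

theorem fold_subst_conj_eq_const {ι : Type*} (L : List ι) (f : ι → PForm V) (p : ι → Bool)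
    (h : ∀ i ∈ L, fold ((f i).subst σ) = const (p i)) :
    fold ((conj (L.map f)).subst σ) = const (L.all p) := by
  induction L with
  | nil => rfl
  | cons i L ih =>
    have h₁ := h i (List.mem_cons_self ..)
    have h₂ := ih fun j hj => h j (List.mem_cons_of_mem _ hj)
    simp only [conj, List.map_cons, List.foldr_cons, PForm.subst, fold, List.all_cons] at h₂ ⊢
    rw [h₁, h₂, const_and]

/-- A disjunction folds to a disjunct if all others fold to `⊥`. -/
theorem fold_subst_disj_eq {A : PForm ℕ} (m i : ℕ) (hi : i < m) (f : ℕ → PForm V)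
    (hA : fold ((f i).subst σ) = A) (h : ∀ j < m, j ≠ i → fold ((f j).subst σ) = fls) :
    fold ((disj ((List.range m).map f)).subst σ) = A := by
  have key : ∀ L : List ℕ, L.Nodup → (∀ j ∈ L, j < m) →
      fold ((disj (L.map f)).subst σ) = if i ∈ L then A else fls := by
    intro L hL hm
    induction L with
    | nil => rfl
    | cons j L ih =>
      have h₂ := ih hL.of_cons fun j hj => hm j (List.mem_cons_of_mem _ hj)
      have hj := (List.nodup_cons.1 hL).1
      have hjm := hm j (List.mem_cons_self ..)
      simp only [disj, List.map_cons, List.foldr_cons, PForm.subst, fold] at h₂ ⊢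
      rw [h₂]
      by_cases hji : j = i
      · subst hji; simp [hA, hj]
      · simp [h j hjm hji, Ne.symm hji]
  rw [key _ List.nodup_range (by simp), if_pos (by simpa using hi)]

end fold_subst

/-! ### Binary indices -/

/-- The number whose lowest binary digits are `f 0, …, f (L - 1)`. -/
def ofDigits (f : ℕ → Bool) (L : ℕ) : ℕ := ∑ j ∈ Finset.range L, if f j then 2 ^ j else 0

theorem ofDigits_lt (f : ℕ → Bool) (L : ℕ) : ofDigits f L < 2 ^ L := by
  induction L with
  | zero => simp [ofDigits]
  | succ L ih =>
    rw [ofDigits, Finset.sum_range_succ, pow_succ]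
    change ofDigits f L + _ < _
    split_ifs <;> omega

theorem testBit_ofDigits (f : ℕ → Bool) (L j : ℕ) (hj : j < L) :
    (ofDigits f L).testBit j = f j := by
  induction L with
  | zero => omega
  | succ L ih =>
    rw [ofDigits, Finset.sum_range_succ]
    change (ofDigits f L + _).testBit j = _
    rcases Nat.lt_succ_iff_lt_or_eq.1 hj with hj | rfl
    · rw [← ih hj]
      split_ifs
      · rw [add_comm, Nat.testBit_two_pow_add_gt hj]
      · rfl
    · cases h : f j
      · simpa using Nat.testBit_lt_two_pow (ofDigits_lt f j)
      · simp only [if_true]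
        rw [add_comm, Nat.testBit_two_pow_add_eq, Nat.testBit_lt_two_pow (ofDigits_lt f j)]
        rfl

theorem eq_ofDigits {f : ℕ → Bool} {L i : ℕ} (hi : i < 2 ^ L) (h : ∀ j < L, i.testBit j = f j) :
    i = ofDigits f L := by
  refine Nat.eq_of_testBit_eq fun j => ?_
  rcases lt_or_ge j L with hj | hj
  · rw [h j hj, testBit_ofDigits f L j hj]
  · have : 2 ^ L ≤ 2 ^ j := Nat.pow_le_pow_right two_pos hj
    rw [Nat.testBit_lt_two_pow (hi.trans_le this),
      Nat.testBit_lt_two_pow ((ofDigits_lt f L).trans_le this)]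

/-! ### The evaluation of an encoded formula on symbolic values -/

/-- `S 0, …, S (numBlocks n)` are the parse stacks of the string `x`. -/
structure IsParse {n : ℕ} (x : Fin n → Bool) (S : ℕ → List (PForm ℕ)) : Prop where
  zero : S 0 = []
  step : ∀ t < numBlocks n, parseStep (S t) (token x t) = some (S (t + 1))

/-- The size of a parse stack grows by at most one in each step. -/
theorem parseStep_size {S S' : List (PForm ℕ)} {τ : Token} (h : parseStep S τ = some S') :
    (S'.map PForm.size).sum ≤ (S.map PForm.size).sum + 1 := by
  rcases τ with _ | i | _ | _ | _ | _ | _ | _ <;> rcases S with _ | ⟨B, _ | ⟨A, S⟩⟩ <;>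
    simp only [parseStep, Option.some.injEq, reduceCtorEq] at h <;> subst h <;>
    simp [PForm.size] <;> omega

namespace IsParse

variable {n : ℕ} {x : Fin n → Bool} {S : ℕ → List (PForm ℕ)}

theorem sum_size_le (h : IsParse x S) {t : ℕ} (ht : t ≤ numBlocks n) :
    ((S t).map PForm.size).sum ≤ t := by
  induction t with
  | zero => simp [h.zero]
  | succ t ih => exact (parseStep_size (h.step t ht)).trans (by have := ih (by omega); omega)

theorem length_le (h : IsParse x S) {t : ℕ} (ht : t ≤ numBlocks n) : (S t).length ≤ t := by
  refine le_trans ?_ (h.sum_size_le ht)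
  simpa using List.length_le_sum_of_one_le ((S t).map PForm.size)
    (by simpa using fun A _ => A.one_le_size)

theorem size_le (h : IsParse x S) {t : ℕ} (ht : t ≤ numBlocks n) {A : PForm ℕ} (hA : A ∈ S t) :
    A.size ≤ t :=
  (List.single_le_sum (by simp) _ (List.mem_map_of_mem hA)).trans (h.sum_size_le ht)

end IsParse

/-- The substitution `σ` describes the evaluation (copy `c`) of the string `x` with parse
stacks `S`, where atom `i` of the encoded formula has the symbolic value `Z i`. -/
structure IsEvalSubst {n : ℕ} (σ : AVar n → PForm ℕ) (x : Fin n → Bool)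
    (S : ℕ → List (PForm ℕ)) (c : Bool) (Z : ℕ → PForm ℕ) : Prop where
  x : ∀ i, σ (.x i) = const (bit x i)
  ok : ∀ t, σ (.ok c t) = tru
  occ : ∀ t j, σ (.occ c t j) = const (decide (j < (S t).length))
  val : ∀ t j, σ (.val c t j) = ((S t).getD j fls).subst Z

namespace IsEvalSubst

variable {n : ℕ} {σ : AVar n → PForm ℕ} {x : Fin n → Bool} {S : ℕ → List (PForm ℕ)} {c : Bool}
  {Z : ℕ → PForm ℕ}

theorem fold_okF (h : IsEvalSubst σ x S c Z) (t : ℕ) : fold ((okF c t).subst σ) = tru := by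
  unfold okF; split_ifs <;> simp [PForm.subst, fold, h.ok]

theorem fold_occF (h : IsEvalSubst σ x S c Z) (hS : IsParse x S) {t : ℕ} (ht : t ≤ numBlocks n)
    (j : ℕ) : fold ((occF c t j).subst σ) = const (decide (j < (S t).length)) := by
  unfold occF
  split_ifs with h₁
  · have := hS.length_le ht
    rw [decide_eq_false (by omega)]; rfl
  · simp only [PForm.subst, h.occ, fold_const]

theorem fold_valF (h : IsEvalSubst σ x S c Z) (hS : IsParse x S) {t : ℕ} (ht : t ≤ numBlocks n)
    (j : ℕ) : fold ((valF c t j).subst σ) = fold (((S t).getD j fls).subst Z) := by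
  unfold valF
  split_ifs with h₁
  · have := hS.length_le ht
    rw [List.getD_eq_default _ _ (by omega)]; rfl
  · simp only [PForm.subst, h.val]

theorem fold_kindF (h : IsEvalSubst σ x S c Z) (a₀ a₁ a₂ : Bool) (t : ℕ) :
    fold ((kindF a₀ a₁ a₂ t).subst σ) = const ((bit x (t * blockLen n) == a₀) &&
      ((bit x (t * blockLen n + 1) == a₁) && (bit x (t * blockLen n + 2) == a₂))) := by
  have key : ∀ b i, fold ((lit b (var (AVar.x i))).subst σ) = const (bit x i == b) := fun b i =>
    fold_subst_lit σ (by simp only [PForm.subst, h.x, fold_const])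
  simp only [kindF, PForm.subst, fold, key, const_and]

theorem fold_lookupF (h : IsEvalSubst σ x S c Z) {Y : ℕ → PForm (AVar n)}
    (hY : ∀ i, (Y i).subst σ = Z i) (t : ℕ) :
    fold ((lookupF Y t).subst σ) = fold (Z (blockIdx x t)) := by
  set f : ℕ → Bool := fun j => bit x (t * blockLen n + 3 + j) with hf
  have hidx : blockIdx x t = ofDigits f (idxLen n) := rfl
  have key : ∀ i : ℕ, fold ((conj ((List.range (idxLen n)).map fun j =>
      lit (i.testBit j) (var (AVar.x (t * blockLen n + 3 + j))))).subst σ) =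
        const ((List.range (idxLen n)).all fun j => f j == i.testBit j) := fun i =>
    fold_subst_conj_eq_const σ _ _ _ fun j _ =>
      fold_subst_lit σ (by simp only [PForm.subst, h.x, fold_const, hf])
  refine fold_subst_disj_eq σ _ (blockIdx x t) (hidx ▸ ofDigits_lt f _) _ ?_ ?_
  · have : ((List.range (idxLen n)).all fun j => f j == (blockIdx x t).testBit j) = true := by
      simp only [List.all_eq_true, List.mem_range, beq_iff_eq]
      intro j hj
      rw [hidx, testBit_ofDigits f _ j hj]
    simp only [PForm.subst, fold, key, this, hY]
    exact sAnd_tru_left _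
  · intro i hi hne
    have : ((List.range (idxLen n)).all fun j => f j == i.testBit j) = false := by
      rw [Bool.eq_false_iff]
      intro hall
      simp only [List.all_eq_true, List.mem_range, beq_iff_eq] at hall
      exact hne (hidx ▸ eq_ofDigits hi fun j hj => (hall j hj).symm)
    simp only [PForm.subst, fold, key, this]
    exact sAnd_fls_left _

/-- Each clause of `satCompF` folds to `⊤`: both sides of the equivalences fold to the same
formula. -/
theorem fold_step (h : IsEvalSubst σ x S c Z) (hS : IsParse x S) {Y : ℕ → PForm (AVar n)}
    (hY : ∀ i, (Y i).subst σ = Z i) {t : ℕ} (ht : t < numBlocks n) :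
    fold ((okNextF c t).subst σ) = tru ∧
    (∀ j, fold ((occNextF c t j).subst σ) = const (decide (j < (S (t + 1)).length))) ∧
    ∀ j, fold ((valNextF c Y t j).subst σ) = fold (((S (t + 1)).getD j fls).subst Z) := by
  have hstep := hS.step t ht
  have hok := h.fold_okF t
  have hocc := h.fold_occF hS ht.le
  have hval := h.fold_valF hS ht.le
  have hkind := fun a₀ a₁ a₂ => h.fold_kindF a₀ a₁ a₂ t
  have hlook := h.fold_lookupF hY t
  simp only [token] at hstep
  generalize bit x (t * blockLen n) = b₀ at hstep hkind
  generalize bit x (t * blockLen n + 1) = b₁ at hstep hkind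
  generalize bit x (t * blockLen n + 2) = b₂ at hstep hkind
  generalize S (t + 1) = S' at hstep ⊢
  generalize S t = R at hstep hocc hval
  have ct : const true = (tru : PForm ℕ) := rfl
  have cf : const false = (fls : PForm ℕ) := rfl
  cases b₀ <;> cases b₁ <;> cases b₂ <;> simp only [Token.ofBits] at hstep <;>
    rcases R with _ | ⟨B, _ | ⟨A, R⟩⟩ <;>
    simp only [parseStep, Option.some.injEq, reduceCtorEq] at hstep <;> subst hstep <;>
    refine ⟨?_, fun j => ?_, fun j => ?_⟩ <;> (try rcases j with _ | _ | j) <;>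
    simp [okNextF, occNextF, valNextF, isPushF, isBinF, pushValF, binValF, disj, conj,
      PForm.subst, fold, hok, hocc, hval, hkind, hlook, ct, cf]

/-- The computation of an encoded formula folds to `⊤`. -/
theorem fold_satCompF (h : IsEvalSubst σ x S c Z) (hS : IsParse x S) {Y : ℕ → PForm (AVar n)}
    (hY : ∀ i, (Y i).subst σ = Z i) : fold ((satCompF c Y).subst σ) = tru := by
  refine fold_subst_conj_eq_tru σ ?_
  simp only [List.mem_map, List.mem_range, forall_exists_index, and_imp,
    forall_apply_eq_imp_iff₂]
  intro t ht
  obtain ⟨h₁, h₂, h₃⟩ := h.fold_step hS hY ht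
  have h₄ := fold_subst_iff_eq_tru σ ((h.fold_okF (t + 1)).trans h₁.symm)
  rw [PForm.subst, fold, h₄, sAnd_tru_left]
  refine fold_subst_conj_eq_tru σ ?_
  simp only [List.mem_map, List.mem_range, forall_exists_index, and_imp,
    forall_apply_eq_imp_iff₂]
  intro j _
  have h₅ := fold_subst_iff_eq_tru σ ((h.fold_occF hS ht j).trans (h₂ j).symm)
  have h₆ := fold_subst_iff_eq_tru σ ((h.fold_valF hS ht j).trans (h₃ j).symm)
  rw [PForm.subst, fold, h₅, h₆, sAnd_tru_left]

/-- The result of the evaluation folds to the encoded formula. -/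
theorem fold_satOutF (h : IsEvalSubst σ x S c Z) (hS : IsParse x S) {ψ : PForm ℕ}
    (hψ : S (numBlocks n) = [ψ]) : fold ((satOutF c).subst σ) = fold (ψ.subst Z) := by
  have h₁ := h.fold_okF (numBlocks n)
  have h₂ := h.fold_occF hS le_rfl
  have h₃ := h.fold_valF hS le_rfl
  have ct : const true = (tru : PForm ℕ) := rfl
  have cf : const false = (fls : PForm ℕ) := rfl
  simp [satOutF, conj, PForm.subst, fold, h₁, h₂, h₃, hψ, ct, cf]

end IsEvalSubst

/-! ### Encoding of formulas -/

/-- Reverse Polish notation. -/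
def rpn : PForm ℕ → List Token
  | .var v => [.var v]
  | .tru => [.tru]
  | .fls => [.fls]
  | .neg A => rpn A ++ [.neg]
  | .and A B => rpn A ++ rpn B ++ [.and]
  | .or A B => rpn A ++ rpn B ++ [.or]
  | .imp A B => rpn A ++ rpn B ++ [.imp]

theorem length_rpn (A : PForm ℕ) : (rpn A).length = A.size := by
  induction A <;> simp_all [rpn, PForm.size, add_assoc]

theorem foldlM_parseStep_rpn (A : PForm ℕ) (S : List (PForm ℕ)) :
    (rpn A).foldlM parseStep S = some (A :: S) := by
  induction A generalizing S <;> simp_all [rpn, List.foldlM_append, parseStep]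

theorem foldlM_parseStep_blank (m : ℕ) (S : List (PForm ℕ)) :
    (List.replicate m Token.blank).foldlM parseStep S = some S := by
  induction m with
  | zero => rfl
  | succ m ih => simp_all [List.replicate_succ, parseStep]

/-- The intermediate stacks of a successful parse. -/
theorem exists_stacks (τ : ℕ → Token) (N : ℕ) (R : List (PForm ℕ))
    (h : ((List.range N).map τ).foldlM parseStep [] = some R) :
    ∃ S : ℕ → List (PForm ℕ), S 0 = [] ∧ (∀ t < N, parseStep (S t) (τ t) = some (S (t + 1))) ∧
      S N = R := by
  induction N generalizing R with
  | zero =>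
    have : R = [] := by simpa [eq_comm] using h
    exact ⟨fun _ => [], rfl, by simp, this.symm⟩
  | succ N ih =>
    rw [List.range_succ, List.map_append, List.foldlM_append] at h
    obtain ⟨R', hR', hR⟩ := Option.bind_eq_some_iff.1 h
    obtain ⟨S, h₀, h₁, h₂⟩ := ih R' hR'
    refine ⟨fun t => if t ≤ N then S t else R, by simpa using h₀, fun t ht => ?_, by simp⟩
    rcases Nat.lt_succ_iff_lt_or_eq.1 ht with ht | rfl
    · simpa [ht.le, Nat.succ_le_of_lt ht] using h₁ t ht
    · simpa [h₂] using hR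

/-- The selecting bits of a symbol. -/
def Token.selector : Token → ℕ → Bool
  | .blank, _ => false
  | .var _, r => r == 2
  | .fls, r => r == 1
  | .tru, r => r == 1 || r == 2
  | .neg, r => r == 0
  | .and, r => r == 0 || r == 2
  | .or, r => r == 0 || r == 1
  | .imp, _ => true

/-- The index written with a symbol. -/
def Token.index : Token → ℕ
  | .var i => i
  | _ => 0

/-- The bits of the block that encodes a symbol. -/
def Token.bits (τ : Token) (r : ℕ) : Bool :=
  if r < 3 then τ.selector r else τ.index.testBit (r - 3)

/-- The string that encodes a sequence of symbols. -/
def encode (n : ℕ) (τ : ℕ → Token) (i : Fin n) : Bool :=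
  (τ (i / blockLen n)).bits (i % blockLen n)

theorem bit_encode {n : ℕ} (τ : ℕ → Token) {t r : ℕ} (ht : t < numBlocks n)
    (hr : r < blockLen n) : bit (encode n τ) (t * blockLen n + r) = (τ t).bits r := by
  have hb : 0 < blockLen n := by omega
  have hlt : t * blockLen n + r < n := by
    have h₁ : (t + 1) * blockLen n ≤ numBlocks n * blockLen n := Nat.mul_le_mul_right _ ht
    have h₂ : numBlocks n * blockLen n ≤ n := Nat.div_mul_le_self n (blockLen n)
    rw [add_mul, one_mul] at h₁
    omega
  have h₁ : (t * blockLen n + r) / blockLen n = t := by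
    rw [mul_comm, Nat.mul_add_div hb, Nat.div_eq_of_lt hr, add_zero]
  have h₂ : (t * blockLen n + r) % blockLen n = r := by
    rw [mul_comm, Nat.mul_add_mod, Nat.mod_eq_of_lt hr]
  simp only [bit, hlt, dif_pos, encode, h₁, h₂]

theorem token_encode {n : ℕ} (τ : ℕ → Token) {t : ℕ} (ht : t < numBlocks n)
    (hτ : (τ t).index < 2 ^ idxLen n) : token (encode n τ) t = τ t := by
  have h₀ := bit_encode τ ht (r := 0) (by simp [blockLen])
  have h₁ := bit_encode τ ht (r := 1) (by simp [blockLen])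
  have h₂ := bit_encode τ ht (r := 2) (by simp [blockLen])
  rw [add_zero] at h₀
  have hidx : blockIdx (encode n τ) t = (τ t).index := by
    refine (eq_ofDigits hτ fun j hj => ?_).symm
    rw [add_assoc, bit_encode τ ht (by simp only [blockLen]; omega)]
    simp [Token.bits]
  simp only [token, h₀, h₁, h₂, hidx]
  cases τ t <;> rfl

/-- Atoms in the order of their occurrence. -/
def varList : PForm ℕ → List ℕ
  | .var v => [v]
  | .tru => []
  | .fls => []
  | .neg A => varList A
  | .and A B => varList A ++ varList B
  | .or A B => varList A ++ varList B
  | .imp A B => varList A ++ varList B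

theorem length_varList_le (A : PForm ℕ) : (varList A).length ≤ A.size := by
  induction A <;> simp [varList, PForm.size] <;> omega

/-- The atoms of a formula can be renamed, in a reversible way, to numbers smaller than its size.
-/
theorem exists_renaming (A : PForm ℕ) : ∃ f g : ℕ → ℕ,
    (A.subst fun v => var (g v)).subst (fun i => var (f i)) = A ∧
      (A.subst fun v => (var (g v) : PForm ℕ)).size = A.size ∧
      ∀ τ ∈ rpn (A.subst fun v => var (g v)), τ.index < A.size := by
  have key : ∀ (L : List ℕ) (B : PForm ℕ), (∀ v ∈ varList B, v ∈ L) →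
      (B.subst fun v => var (L.idxOf v)).subst (fun i => var (L.getD i 0)) = B ∧
      (B.subst fun v => (var (L.idxOf v) : PForm ℕ)).size = B.size ∧
      ∀ τ ∈ rpn (B.subst fun v => var (L.idxOf v)), τ.index < L.length ∨ τ.index = 0 := by
    intro L B hB
    induction B with
    | var v =>
      have hv : L.idxOf v < L.length := List.idxOf_lt_length_iff.2 (hB v (by simp [varList]))
      refine ⟨?_, rfl, ?_⟩
      · rw [PForm.subst, PForm.subst, List.getD_eq_getElem _ _ hv, List.getElem_idxOf]
      · simp [PForm.subst, rpn, Token.index, hv]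
    | tru => exact ⟨rfl, rfl, by simp [PForm.subst, rpn, Token.index]⟩
    | fls => exact ⟨rfl, rfl, by simp [PForm.subst, rpn, Token.index]⟩
    | neg A ih =>
      obtain ⟨h₁, h₂, h₃⟩ := ih hB
      refine ⟨by simp only [PForm.subst, h₁], by simp only [PForm.subst, PForm.size, h₂], ?_⟩
      intro τ hτ
      simp only [PForm.subst, rpn, List.mem_append, List.mem_singleton] at hτ
      rcases hτ with hτ | rfl
      · exact h₃ τ hτ
      · exact Or.inr rfl
    | and A B ihA ihB | or A B ihA ihB | imp A B ihA ihB =>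
      obtain ⟨h₁, h₂, h₃⟩ := ihA fun v hv => hB v (List.mem_append_left _ hv)
      obtain ⟨h₁', h₂', h₃'⟩ := ihB fun v hv => hB v (List.mem_append_right _ hv)
      refine ⟨by simp only [PForm.subst, h₁, h₁'], by simp only [PForm.subst, PForm.size, h₂, h₂'],
        ?_⟩
      intro τ hτ
      simp only [PForm.subst, rpn, List.mem_append, List.mem_singleton] at hτ
      rcases hτ with (hτ | hτ) | rfl
      · exact h₃ τ hτ
      · exact h₃' τ hτ
      · exact Or.inr rfl
  obtain ⟨h₁, h₂, h₃⟩ := key (varList A) A fun _ h => h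
  refine ⟨_, _, h₁, h₂, fun τ hτ => ?_⟩
  have := length_varList_le A
  have := A.one_le_size
  rcases h₃ τ hτ with h | h <;> omega

/-- A formula that is not longer than the number of blocks has, after a renaming of atoms, an
encoding. -/
theorem exists_isParse {n : ℕ} (A : PForm ℕ) (hn : A.size ≤ numBlocks n)
    (hn' : A.size ≤ 2 ^ idxLen n) : ∃ (x : Fin n → Bool) (S : ℕ → List (PForm ℕ))
      (f g : ℕ → ℕ), IsParse x S ∧ S (numBlocks n) = [A.subst fun v => var (g v)] ∧
        (A.subst fun v => var (g v)).subst (fun i => var (f i)) = A ∧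
        ∀ t, ∀ D ∈ S t, D.size ≤ n := by
  obtain ⟨f, g, hf, hsize, hidx⟩ := exists_renaming A
  set A' := A.subst fun v => (var (g v) : PForm ℕ)
  set τ : ℕ → Token := fun t => (rpn A').getD t .blank with hτ
  have hlen : (rpn A').length ≤ numBlocks n := by rw [length_rpn, hsize]; exact hn
  have hlist : (List.range (numBlocks n)).map τ =
      rpn A' ++ List.replicate (numBlocks n - (rpn A').length) .blank := by
    refine List.ext_getElem (by simp; omega) fun i h₁ h₂ => ?_
    simp only [List.getElem_map, List.getElem_range, hτ, List.getElem_append]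
    split_ifs with h
    · rw [List.getD_eq_getElem _ _ h]
    · rw [List.getD_eq_default _ _ (by omega), List.getElem_replicate]
  have hparse : ((List.range (numBlocks n)).map τ).foldlM parseStep [] = some [A'] := by
    rw [hlist, List.foldlM_append, foldlM_parseStep_rpn]
    exact foldlM_parseStep_blank _ _
  obtain ⟨S, h₀, h₁, h₂⟩ := exists_stacks τ _ _ hparse
  have htoken : ∀ t < numBlocks n, token (encode n τ) t = τ t := by
    refine fun t ht => token_encode τ ht ?_
    by_cases h : t < (rpn A').length
    · simp only [hτ, List.getD_eq_getElem _ _ h]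
      exact (hidx _ (List.getElem_mem h)).trans_le hn'
    · simp only [hτ, List.getD_eq_default _ _ (not_lt.1 h)]
      exact Nat.two_pow_pos _
  have hparse' : IsParse (encode n τ) S := ⟨h₀, fun t ht => htoken t ht ▸ h₁ t ht⟩
  -- the stacks after the end of the string are irrelevant, but should not be large
  refine ⟨encode n τ, fun t => S (min t (numBlocks n)), f, g, ⟨by simpa using h₀, fun t ht => ?_⟩,
    by simpa using h₂, hf, fun t D hD => ?_⟩
  · simpa only [min_eq_left ht.le, min_eq_left (Nat.succ_le_of_lt ht)] using hparse'.step t ht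
  · exact (hparse'.size_le (min_le_right _ _) hD).trans
      ((min_le_right _ _).trans (Nat.div_le_self _ _))

/-! ### Wires of circuits -/

/-- The values of all wires after running the gates `G`, starting from wires with values `v`. -/
def runGates (G : List Gate) (v : List Bool) : List Bool :=
  G.foldl (fun v G => v ++ [G.op (v.getD G.left false) (v.getD G.right false)]) v

theorem getD_runGates_of_lt (G : List Gate) (v : List Bool) {j : ℕ} (hj : j < v.length) :
    (runGates G v).getD j false = v.getD j false := by
  induction G generalizing v with
  | nil => rfl
  | cons g G ih =>
    rw [runGates, List.foldl_cons]
    refine (ih _ (by simp; omega)).trans ?_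
    rw [List.getD_append _ _ _ _ hj]

theorem getD_runGates (G : List Gate) (v : List Bool)
    (h : ∀ (g : ℕ) (hg : g < G.length), G[g].left < v.length + g ∧ G[g].right < v.length + g)
    (g : ℕ) (hg : g < G.length) : (runGates G v).getD (v.length + g) false =
      G[g].op ((runGates G v).getD G[g].left false) ((runGates G v).getD G[g].right false) := by
  induction G generalizing v g with
  | nil => simp at hg
  | cons g₀ G ih =>
    set v' := v ++ [g₀.op (v.getD g₀.left false) (v.getD g₀.right false)] with hv'
    have hrun : runGates (g₀ :: G) v = runGates G v' := rfl
    have hlen : v'.length = v.length + 1 := by simp [hv']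
    cases g with
    | zero =>
      obtain ⟨h₁, h₂⟩ := h 0 hg
      simp only [List.getElem_cons_zero, add_zero] at h₁ h₂ ⊢
      rw [getD_runGates_of_lt _ _ h₁, getD_runGates_of_lt _ _ h₂, hrun,
        getD_runGates_of_lt _ _ (by omega), hv', List.getD_append_right _ _ _ _ le_rfl]
      simp
    | succ g =>
      have := ih v' (fun g hg' => by
        have := h (g + 1) (by simpa using hg')
        rw [hlen]
        simpa [add_assoc, add_comm, add_left_comm] using this) g (by simpa using hg)
      rw [hrun]
      simpa [hlen, add_assoc, add_comm, add_left_comm] using this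

theorem getD_ofFn_eq_bit {n : ℕ} (x : Fin n → Bool) (j : ℕ) :
    (List.ofFn x).getD j false = bit x j := by
  by_cases h : j < n <;> simp [bit, h]

namespace Circuit

variable {n : ℕ} {C : Circuit}

theorem getD_wires_of_lt (C : Circuit) (x : Fin n → Bool) {j : ℕ} (hj : j < n) :
    (C.wires (List.ofFn x)).getD j false = bit x j := by
  rw [← getD_ofFn_eq_bit]
  exact getD_runGates_of_lt _ _ (by simpa using hj)

theorem getD_wires (hC : C.WellFormed n) (x : Fin n → Bool) {g : ℕ} (hg : g < C.gates.length) :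
    (C.wires (List.ofFn x)).getD (n + g) false =
      C.gates[g].op ((C.wires (List.ofFn x)).getD C.gates[g].left false)
        ((C.wires (List.ofFn x)).getD C.gates[g].right false) := by
  have := getD_runGates C.gates (List.ofFn x) (by simpa using hC.1) g hg
  simp only [List.length_ofFn] at this
  exact this

end Circuit

/-- A circuit can be padded with idle gates to any larger size. -/
theorem SatInCircuit.exists_size_eq {n s : ℕ} (h : SatInCircuit n s) :
    ∃ (C : Circuit) (o : ℕ), C.WellFormed n ∧ C.outs = [o] ∧ C.gates.length = s ∧
      ComputesSat n C := by
  obtain ⟨C, ⟨⟨hwf, hwf'⟩, hout, hsize⟩, hC⟩ := h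
  obtain ⟨o, ho⟩ := List.length_eq_one_iff.1 hout
  have hsize' : C.gates.length ≤ s := hsize
  set D : List Gate := List.replicate (s - C.gates.length) ⟨fun _ _ => false, 0, 0⟩ with hD
  have ho' : o < n + C.gates.length := hwf' o (by simp [ho])
  refine ⟨⟨C.gates ++ D, C.outs⟩, o, ⟨fun g hg => ?_, fun o' ho' => ?_⟩, ho, ?_, fun x => ?_⟩
  · by_cases h : g < C.gates.length
    · simpa only [List.getElem_append_left h] using hwf g h
    · simp only [List.getElem_append_right (not_lt.1 h), hD, List.getElem_replicate]
      omega
  · refine (hwf' o' ho').trans_le ?_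
    simp only [Circuit.size, List.length_append]; omega
  · simp only [List.length_append, hD, List.length_replicate]; omega
  · have key : Circuit.outBit ⟨C.gates ++ D, C.outs⟩ x 0 = C.outBit x 0 := by
      have hlen : ∀ (G : List Gate) (v : List Bool),
          (runGates G v).length = v.length + G.length := by
        intro G
        induction G with
        | nil => simp [runGates]
        | cons g G ih =>
          intro v
          refine (ih _).trans ?_
          simp; omega
      have : (⟨C.gates ++ D, C.outs⟩ : Circuit).wires (List.ofFn x) =
          runGates D (C.wires (List.ofFn x)) := by
        simp only [Circuit.wires, runGates, List.foldl_append]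
      simp only [Circuit.outBit, this]
      simp only [ho, List.map_cons, List.getD_cons_zero]
      refine getD_runGates_of_lt _ _ ?_
      have h := hlen C.gates (List.ofFn x)
      rw [List.length_ofFn] at h
      exact ho'.trans_eq h.symm
    exact (by rw [AgreesAt, key]; exact hC x)

/-! ### Evaluation of the circuit formulas -/

section eval

variable {V : Type} (a : V → Bool)

theorem eval_conj (L : List (PForm V)) : (conj L).eval a = L.all (PForm.eval a) := by
  induction L with
  | nil => rfl
  | cons A L ih => simp only [conj, List.foldr_cons, PForm.eval, List.all_cons] at ih ⊢; rw [ih]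

theorem eval_disj (L : List (PForm V)) : (disj L).eval a = L.any (PForm.eval a) := by
  induction L with
  | nil => rfl
  | cons A L ih => simp only [disj, List.foldr_cons, PForm.eval, List.any_cons] at ih ⊢; rw [ih]

theorem eval_iff (A B : PForm V) : (iff A B).eval a = (A.eval a == B.eval a) := by
  simp only [iff, PForm.eval]; cases A.eval a <;> cases B.eval a <;> rfl

theorem eval_gateF (f : Bool → Bool → PForm V) (A B : PForm V) :
    (gateF f A B).eval a = (f (A.eval a) (B.eval a)).eval a := by
  simp only [gateF, eval_disj, List.any_cons, List.any_nil, PForm.eval]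
  cases A.eval a <;> cases B.eval a <;> simp

theorem eval_exactlyOneF {n : ℕ} (a : AVar n → Bool) {m p : ℕ} (hp : p < m)
    {f : ℕ → PForm (AVar n)} (hf : ∀ j, (f j).eval a = decide (j = p)) :
    (exactlyOneF m f).eval a = true := by
  simp only [exactlyOneF, PForm.eval, eval_conj, eval_disj, Bool.and_eq_true, List.any_eq_true,
    List.all_eq_true, List.mem_map, List.mem_range, forall_exists_index, and_imp,
    forall_apply_eq_imp_iff₂, hf]
  refine ⟨⟨f p, ⟨p, hp, rfl⟩, by simp [hf]⟩, fun i _ j hj => ?_⟩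
  by_cases h : i = p <;> by_cases h' : j = p <;> simp [h, h']; omega

theorem eval_selectF {n : ℕ} (a : AVar n → Bool) {m p : ℕ} (hp : p < m)
    {f : ℕ → PForm (AVar n)} (hf : ∀ j, (f j).eval a = decide (j = p))
    (wire : ℕ → PForm (AVar n)) : (selectF m f wire).eval a = (wire p).eval a := by
  rw [Bool.eq_iff_iff]
  simp only [selectF, eval_disj, List.any_eq_true, List.mem_map, List.mem_range,
    exists_exists_and_eq_and, PForm.eval, hf, Bool.and_eq_true, decide_eq_true_eq]
  exact ⟨fun ⟨j, _, h, h'⟩ => h ▸ h', fun h => ⟨p, hp, rfl, h⟩⟩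

end eval

/-- The atoms of `alpha` that carry the input `x`, the computation of `B` on `x`, the description
of the circuit `C` with output wire `o`, and its computations are assigned their intended values.
The values of the remaining atoms are irrelevant. -/
def intended {n : ℕ} (x : Fin n → Bool) (B C : Circuit) (o : ℕ) : AVar n → Bool
  | .x i => bit x i
  | .w g => (B.wires (List.ofFn x)).getD (n + g) false
  | .op g p q => (C.gates[g]?.map fun G => G.op p q).getD false
  | .left g j => decide (j = (C.gates[g]?.map Gate.left).getD 0)
  | .right g j => decide (j = (C.gates[g]?.map Gate.right).getD 0)
  | .out j => decide (j = o)
  | .v z g => (C.wires (List.ofFn z)).getD (n + g) false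
  | _ => false

section intended

variable {n : ℕ} (x : Fin n → Bool) {B C : Circuit} {o : ℕ}

theorem eval_wireBF (C : Circuit) (o j : ℕ) : (wireBF j).eval (intended x B C o) =
    (B.wires (List.ofFn x)).getD j false := by
  unfold wireBF
  split_ifs with h
  · rw [Circuit.getD_wires_of_lt _ _ h]; rfl
  · simp only [PForm.eval, intended, Nat.add_sub_cancel' (not_lt.1 h)]

theorem eval_compBF (hB : B.WellFormed n) (C : Circuit) (o : ℕ) :
    (compBF B).eval (intended x B C o) = true := by
  simp only [compBF, eval_conj, List.all_eq_true, List.forall_mem_ofFn_iff, eval_iff, eval_gateF,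
    eval_const, eval_wireBF, PForm.eval, beq_iff_eq]
  exact fun g => Circuit.getD_wires hB x g.2

theorem eval_wireCF (B C : Circuit) (o : ℕ) (z : Fin n → Bool) (j : ℕ) :
    (wireCF z j).eval (intended x B C o) = (C.wires (List.ofFn z)).getD j false := by
  unfold wireCF
  split_ifs with h
  · rw [Circuit.getD_wires_of_lt _ _ h, eval_const]
  · simp only [PForm.eval, intended, Nat.add_sub_cancel' (not_lt.1 h)]

theorem eval_isCircuitF (hC : C.WellFormed n) (B : Circuit) (ho : o < n + C.gates.length) :
    (isCircuitF C.gates.length).eval (intended x B C o) = true := by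
  simp only [isCircuitF, PForm.eval, eval_conj, Bool.and_eq_true, List.all_eq_true,
    List.mem_map, List.mem_range, forall_exists_index, and_imp, forall_apply_eq_imp_iff₂]
  refine ⟨fun g hg => ⟨eval_exactlyOneF _ (hC.1 g hg).1 fun j => ?_,
    eval_exactlyOneF _ (hC.1 g hg).2 fun j => ?_⟩, eval_exactlyOneF _ ho fun j => rfl⟩ <;>
  simp [PForm.eval, intended, hg]

theorem eval_compCF (hC : C.WellFormed n) (B : Circuit) (o : ℕ) (z : Fin n → Bool) :
    (compCF C.gates.length z).eval (intended x B C o) = true := by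
  simp only [compCF, eval_conj, List.all_eq_true, List.mem_map, List.mem_range,
    forall_exists_index, and_imp, forall_apply_eq_imp_iff₂, eval_iff, eval_gateF, beq_iff_eq]
  intro g hg
  rw [eval_selectF _ (hC.1 g hg).1 (fun j => by simp [PForm.eval, intended, hg]),
    eval_selectF _ (hC.1 g hg).2 (fun j => by simp [PForm.eval, intended, hg]),
    eval_wireCF, eval_wireCF]
  simp only [PForm.eval, intended, hg, List.getElem?_eq_getElem, Option.map_some,
    Option.getD_some]
  exact Circuit.getD_wires hC z hg

theorem eval_outCF (B : Circuit) (ho : o < n + C.gates.length) (hout : C.outs = [o])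
    (z : Fin n → Bool) :
    (outCF C.gates.length z).eval (intended x B C o) = C.outBit z 0 := by
  rw [outCF, eval_selectF _ ho fun j => rfl, eval_wireCF, Circuit.outBit, hout]
  rfl

open Classical in
/-- The disjunct of `alpha` that says that a circuit errs on `A` is false for a circuit that
computes `SAT_n`. -/
theorem eval_circuit_disjunct (hC : C.WellFormed n) (B : Circuit) (hout : C.outs = [o])
    (hsat : ComputesSat n C) (A : Finset (Fin n → Bool)) :
    (imp (isCircuitF C.gates.length) (disj (A.toList.map fun z =>
      imp (compCF C.gates.length z) (neg (iff (outCF C.gates.length z)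
        (const (decide (Satisfiable z)))))))).eval (intended x B C o) = false := by
  have ho : o < n + C.gates.length := hC.2 o (by simp [hout])
  have key : ∀ z : Fin n → Bool, C.outBit z 0 = decide (Satisfiable z) := fun z => by
    rw [Bool.eq_iff_iff, decide_eq_true_eq]; exact hsat z
  simp only [PForm.eval, eval_isCircuitF x hC B ho, eval_disj, Bool.not_true, Bool.false_or]
  simp only [List.any_eq_false, List.mem_map, forall_exists_index, and_imp,
    forall_apply_eq_imp_iff₂, PForm.eval, eval_compCF x hC B, eval_iff, eval_const,
    eval_outCF x B ho hout, key]
  simp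

end intended

/-! ### Atoms of the circuit formulas -/

section vars

variable {n : ℕ} {P : AVar n → Prop}

theorem forall_vars_conj {V : Type} {P : V → Prop} (L : List (PForm V)) :
    (∀ v ∈ (conj L).vars, P v) ↔ ∀ A ∈ L, ∀ v ∈ A.vars, P v := by
  induction L with
  | nil => simp [conj, vars]
  | cons A L ih =>
    simp only [conj, List.foldr_cons, vars, Set.mem_union, or_imp, forall_and,
      List.forall_mem_cons] at ih ⊢
    rw [ih]

theorem forall_vars_disj {V : Type} {P : V → Prop} (L : List (PForm V)) :
    (∀ v ∈ (disj L).vars, P v) ↔ ∀ A ∈ L, ∀ v ∈ A.vars, P v := by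
  induction L with
  | nil => simp [disj, vars]
  | cons A L ih =>
    simp only [disj, List.foldr_cons, vars, Set.mem_union, or_imp, forall_and,
      List.forall_mem_cons] at ih ⊢
    rw [ih]

theorem forall_vars_and {V : Type} {P : V → Prop} (A B : PForm V) :
    (∀ v ∈ (and A B).vars, P v) ↔ (∀ v ∈ A.vars, P v) ∧ ∀ v ∈ B.vars, P v := by
  simp only [vars, Set.mem_union, or_imp, forall_and]

theorem forall_vars_imp {V : Type} {P : V → Prop} (A B : PForm V) :
    (∀ v ∈ (imp A B).vars, P v) ↔ (∀ v ∈ A.vars, P v) ∧ ∀ v ∈ B.vars, P v := by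
  simp only [vars, Set.mem_union, or_imp, forall_and]

theorem forall_vars_iff {V : Type} {P : V → Prop} (A B : PForm V) :
    (∀ v ∈ (iff A B).vars, P v) ↔ (∀ v ∈ A.vars, P v) ∧ ∀ v ∈ B.vars, P v := by
  simp only [iff, forall_vars_and, forall_vars_imp]; tauto

theorem forall_vars_neg {V : Type} {P : V → Prop} (A : PForm V) :
    (∀ v ∈ (neg A).vars, P v) ↔ ∀ v ∈ A.vars, P v := Iff.rfl

theorem forall_vars_var {V : Type} {P : V → Prop} (w : V) :
    (∀ v ∈ (var w).vars, P v) ↔ P w := by simp [vars]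

theorem forall_vars_const {V : Type} {P : V → Prop} (b : Bool) :
    ∀ v ∈ (const b : PForm V).vars, P v := by cases b <;> simp [const, vars]

theorem forall_vars_gateF {V : Type} {P : V → Prop} {f : Bool → Bool → PForm V} {A B : PForm V}
    (hf : ∀ p q, ∀ v ∈ (f p q).vars, P v) (hA : ∀ v ∈ A.vars, P v) (hB : ∀ v ∈ B.vars, P v) :
    ∀ v ∈ (gateF f A B).vars, P v := by
  simp only [gateF, forall_vars_disj, List.forall_mem_cons, forall_vars_and, forall_vars_neg,
    List.not_mem_nil, false_imp_iff, implies_true, and_true]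
  exact ⟨⟨hf _ _, hA, hB⟩, ⟨hf _ _, hA, hB⟩, ⟨hf _ _, hA, hB⟩, hf _ _, hA, hB⟩

theorem forall_vars_wireBF (hx : ∀ i, P (.x i)) (hw : ∀ g, P (.w g)) (j : ℕ) :
    ∀ v ∈ (wireBF j).vars, P v := by
  unfold wireBF; split_ifs
  · exact (forall_vars_var _).2 (hx _)
  · exact (forall_vars_var _).2 (hw _)

theorem forall_vars_compBF (hx : ∀ i, P (.x i)) (hw : ∀ g, P (.w g)) (B : Circuit) :
    ∀ v ∈ (compBF B).vars, P v := by
  simp only [compBF, forall_vars_conj, List.forall_mem_ofFn_iff, forall_vars_iff]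
  exact fun g => ⟨(forall_vars_var _).2 (hw _), forall_vars_gateF
    (fun p q => forall_vars_const _) (forall_vars_wireBF hx hw _) (forall_vars_wireBF hx hw _)⟩

theorem forall_vars_exactlyOneF {m : ℕ} {f : ℕ → PForm (AVar n)}
    (hf : ∀ j, ∀ v ∈ (f j).vars, P v) : ∀ v ∈ (exactlyOneF m f).vars, P v := by
  simp only [exactlyOneF, forall_vars_and, forall_vars_conj, forall_vars_disj, forall_vars_neg,
    List.mem_map, forall_exists_index, and_imp, forall_apply_eq_imp_iff₂]
  exact ⟨fun i _ => hf i, fun i _ j _ => ⟨hf i, hf j⟩⟩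

theorem forall_vars_selectF {m : ℕ} {f wire : ℕ → PForm (AVar n)}
    (hf : ∀ j, ∀ v ∈ (f j).vars, P v) (hw : ∀ j, ∀ v ∈ (wire j).vars, P v) :
    ∀ v ∈ (selectF m f wire).vars, P v := by
  simp only [selectF, forall_vars_and, forall_vars_disj, List.mem_map, forall_exists_index,
    and_imp, forall_apply_eq_imp_iff₂]
  exact fun i _ => ⟨hf i, hw i⟩

theorem forall_vars_wireCF (hv : ∀ z g, P (.v z g)) (z : Fin n → Bool) (j : ℕ) :
    ∀ v ∈ (wireCF z j).vars, P v := by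
  unfold wireCF; split_ifs
  · exact forall_vars_const _
  · exact (forall_vars_var _).2 (hv _ _)

theorem forall_vars_circuit_disjunct (hop : ∀ g p q, P (.op g p q)) (hl : ∀ g j, P (.left g j))
    (hr : ∀ g j, P (.right g j)) (ho : ∀ j, P (.out j)) (hv : ∀ z g, P (.v z g)) (s : ℕ)
    (L : List (Fin n → Bool)) (b : (Fin n → Bool) → Bool) :
    ∀ v ∈ (imp (isCircuitF s) (disj (L.map fun z =>
      imp (compCF s z) (neg (iff (outCF s z) (const (b z))))))).vars, P v := by
  simp only [isCircuitF, compCF, outCF, forall_vars_imp, forall_vars_and, forall_vars_conj,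
    forall_vars_disj, forall_vars_neg, forall_vars_iff, List.mem_map, forall_exists_index,
    and_imp, forall_apply_eq_imp_iff₂, forall_vars_var]
  have hw := forall_vars_wireCF hv
  refine ⟨⟨fun g _ => ⟨forall_vars_exactlyOneF ?_, forall_vars_exactlyOneF ?_⟩,
    forall_vars_exactlyOneF ?_⟩, fun z _ => ⟨fun g _ => ⟨hv _ _, forall_vars_gateF ?_
      (forall_vars_selectF ?_ (hw z)) (forall_vars_selectF ?_ (hw z))⟩,
      forall_vars_selectF ?_ (hw z), forall_vars_const _⟩⟩ <;>
  simp only [forall_vars_var] <;> intros <;> simp only [hop, hl, hr, ho]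

end vars

/-! ### The instance of `alpha` -/

/-- The substitution for the atoms of `alpha`: the evaluation of `x` with parse stacks `S` under
the assignment `y` is described symbolically, by the formulas on the stack with atom `i` renamed to
`f i`; all other atoms become constants. -/
def instanceSubst {n : ℕ} (x : Fin n → Bool) (S : ℕ → List (PForm ℕ)) (f : ℕ → ℕ)
    (B C : Circuit) (o : ℕ) : AVar n → PForm ℕ
  | .y i => var (f i)
  | .ok _ _ => tru
  | .occ _ t j => const (decide (j < (S t).length))
  | .val false t j => ((S t).getD j fls).subst fun i => var (f i)
  | .val true t j => ((S t).getD j fls).subst fun i => const (B.outBit x i)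
  | w => const (intended x B C o w)

section

variable {n : ℕ} {x : Fin n → Bool} {S : ℕ → List (PForm ℕ)} {f : ℕ → ℕ} {B C : Circuit} {o : ℕ}

theorem isEvalSubst_false : IsEvalSubst (instanceSubst x S f B C o) x S false
    fun i => var (f i) :=
  ⟨fun _ => rfl, fun _ => rfl, fun _ _ => rfl, fun _ _ => rfl⟩

theorem isEvalSubst_true : IsEvalSubst (instanceSubst x S f B C o) x S true
    fun i => const (B.outBit x i) :=
  ⟨fun _ => rfl, fun _ => rfl, fun _ _ => rfl, fun _ _ => rfl⟩

theorem subst_outBF (i : ℕ) : (outBF B i).subst (instanceSubst x S f B C o) =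
    const (B.outBit x i) := by
  have key : ∀ j, (wireBF j).subst (instanceSubst x S f B C o) =
      const ((B.wires (List.ofFn x)).getD j false) := by
    intro j
    unfold wireBF
    split_ifs with h
    · rw [Circuit.getD_wires_of_lt _ _ h]; rfl
    · simp only [PForm.subst, instanceSubst, intended, Nat.add_sub_cancel' (not_lt.1 h)]
  unfold outBF Circuit.outBit
  by_cases h : i < B.outs.length
  · simp [h, key]
  · simp only [List.getD_eq_default _ _ (show (List.map wireBF B.outs).length ≤ i by
      simpa using h), List.getD_eq_default _ _ (show (List.map (fun o =>
        (B.wires (List.ofFn x)).getD o false) B.outs).length ≤ i by simpa using h)]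
    rfl

/-- With a circuit that computes `SAT_n` for `C`, and the code of (a renaming of) `¬φ` for `x`, the
formula `alpha` folds to the same formula as `¬φ → ⊥`. -/
theorem fold_alpha_instance (hx : IsParse x S) {φ : PForm ℕ} {g : ℕ → ℕ}
    (hψ : S (numBlocks n) = [(neg φ).subst fun v => var (g v)])
    (hφ : φ.Tautology)
    (hf : (((neg φ).subst fun v => var (g v)).subst fun i => var (f i)) = neg φ) (hB : B.WellFormed n)
    (hC : C.WellFormed n) (hout : C.outs = [o]) (hsat : ComputesSat n C)
    (A : Finset (Fin n → Bool)) :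
    fold ((alpha n C.gates.length A B).subst (instanceSubst x S f B C o)) =
      fold (imp (neg φ) fls) := by
  have h₀ := isEvalSubst_false (x := x) (S := S) (f := f) (B := B) (C := C) (o := o)
  have h₁ := isEvalSubst_true (x := x) (S := S) (f := f) (B := B) (C := C) (o := o)
  have hcomp₀ := h₀.fold_satCompF hx (Y := fun i => var (.y i)) fun i => rfl
  have hcomp₁ := h₁.fold_satCompF hx subst_outBF
  have hout₀ := h₀.fold_satOutF hx hψ
  have hout₁ := h₁.fold_satOutF hx hψ
  have hcompB : fold ((compBF B).subst (instanceSubst x S f B C o)) = tru := by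
    rw [fold_subst_eq_const (a := intended x B C o) _ (forall_vars_compBF
      (fun _ => fold_const _) (fun _ => fold_const _) B), eval_compBF x hB]
    rfl
  have hdisj := fold_subst_eq_const (σ := instanceSubst x S f B C o) (a := intended x B C o) _
    (forall_vars_circuit_disjunct (fun _ _ _ => fold_const _) (fun _ _ => fold_const _)
      (fun _ _ => fold_const _) (fun _ => fold_const _) (fun _ _ => fold_const _)
      C.gates.length A.toList fun z => @decide (Satisfiable z) (Classical.propDecidable _))
  rw [eval_circuit_disjunct x hC B hout hsat A] at hdisj
  -- a renaming of `¬φ` is unsatisfiable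
  have hunsat : fold (((neg φ).subst fun v => var (g v)).subst fun i => const (B.outBit x i)) = fls := by
    rw [fold_subst_eq_const (a := fun i => B.outBit x i) _ fun _ _ => fold_const _,
      eval_subst, PForm.eval, hφ]
    rfl
  rw [hunsat] at hout₁
  rw [hf] at hout₀
  simp only [alpha, PForm.subst, fold] at hdisj ⊢
  rw [hdisj]
  simp only [conj, List.foldr_cons, List.foldr_nil, PForm.subst, fold, hcomp₀, hcomp₁, hcompB,
    hout₀, hout₁, sAnd_tru_left, sImp_tru_left]
  exact sOr_fls_right _

end

/-! ### The size of `alpha` -/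

section size

variable {V : Type}

theorem size_conj_le {L : List (PForm V)} {M m : ℕ} (hm : L.length ≤ m)
    (h : ∀ A ∈ L, A.size ≤ M) : (conj L).size ≤ m * (M + 1) + 1 := by
  refine le_trans ?_ (Nat.add_le_add_right (Nat.mul_le_mul_right (M + 1) hm) 1)
  clear hm
  induction L with
  | nil => simp [conj, PForm.size]
  | cons A L ih =>
    have h₁ := h A (List.mem_cons_self ..)
    have h₂ := ih fun B hB => h B (List.mem_cons_of_mem _ hB)
    simp only [conj, List.foldr_cons, PForm.size, List.length_cons] at h₂ ⊢
    nlinarith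

theorem size_disj_le {L : List (PForm V)} {M m : ℕ} (hm : L.length ≤ m)
    (h : ∀ A ∈ L, A.size ≤ M) : (disj L).size ≤ m * (M + 1) + 1 := by
  refine le_trans ?_ (Nat.add_le_add_right (Nat.mul_le_mul_right (M + 1) hm) 1)
  clear hm
  induction L with
  | nil => simp [disj, PForm.size]
  | cons A L ih =>
    have h₁ := h A (List.mem_cons_self ..)
    have h₂ := ih fun B hB => h B (List.mem_cons_of_mem _ hB)
    simp only [disj, List.foldr_cons, PForm.size, List.length_cons] at h₂ ⊢
    nlinarith

theorem size_conj_range_le {f : ℕ → PForm V} {M m l : ℕ} (hl : l ≤ m)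
    (h : ∀ i < l, (f i).size ≤ M) : (conj ((List.range l).map f)).size ≤ m * (M + 1) + 1 :=
  size_conj_le (by simpa using hl) (by simpa using h)

theorem size_disj_range_le {f : ℕ → PForm V} {M m l : ℕ} (hl : l ≤ m)
    (h : ∀ i < l, (f i).size ≤ M) : (disj ((List.range l).map f)).size ≤ m * (M + 1) + 1 :=
  size_disj_le (by simpa using hl) (by simpa using h)

theorem size_iff (A B : PForm V) : (iff A B).size = 2 * A.size + 2 * B.size + 3 := by
  simp only [iff, PForm.size]; ring

theorem size_lit_le (b : Bool) (A : PForm V) : (lit b A).size ≤ A.size + 1 := by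
  cases b <;> simp [lit, PForm.size]

theorem size_const (b : Bool) : (const b : PForm V).size = 1 := by
  cases b <;> rfl

variable {n : ℕ}

theorem size_kindF_le (a b c : Bool) (t : ℕ) : (kindF a b c t : PForm (AVar n)).size ≤ 8 := by
  have := fun b i => size_lit_le b (var (AVar.x i : AVar n))
  simp only [PForm.size] at this
  have h₁ := this a (t * blockLen n)
  have h₂ := this b (t * blockLen n + 1)
  have h₃ := this c (t * blockLen n + 2)
  simp only [kindF, PForm.size]; omega

theorem size_okF_le (c : Bool) (t : ℕ) : (okF c t : PForm (AVar n)).size ≤ 1 := by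
  unfold okF; split_ifs <;> exact le_rfl

theorem size_occF_le (c : Bool) (t j : ℕ) : (occF c t j : PForm (AVar n)).size ≤ 1 := by
  unfold occF; split_ifs <;> exact le_rfl

theorem size_valF_le (c : Bool) (t j : ℕ) : (valF c t j : PForm (AVar n)).size ≤ 1 := by
  unfold valF; split_ifs <;> exact le_rfl

theorem size_isPushF_le (t : ℕ) : (isPushF t : PForm (AVar n)).size ≤ 28 := by
  simp only [isPushF, disj, List.foldr_cons, List.foldr_nil, PForm.size]
  have := fun a b c => size_kindF_le (n := n) a b c t
  linarith [this false false true, this false true false, this false true true]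

theorem size_isBinF_le (t : ℕ) : (isBinF t : PForm (AVar n)).size ≤ 28 := by
  simp only [isBinF, disj, List.foldr_cons, List.foldr_nil, PForm.size]
  have := fun a b c => size_kindF_le (n := n) a b c t
  linarith [this true false true, this true true false, this true true true]

theorem size_okNextF_le (c : Bool) (t : ℕ) : (okNextF c t : PForm (AVar n)).size ≤ 50 := by
  simp only [okNextF, conj, List.foldr_cons, List.foldr_nil, PForm.size]
  linarith [size_okF_le (n := n) c t, size_kindF_le (n := n) true false false t,
    size_occF_le (n := n) c t 0, size_occF_le (n := n) c t 1, size_isBinF_le (n := n) t]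

theorem size_occNextF_le (c : Bool) (t j : ℕ) :
    (occNextF c t j : PForm (AVar n)).size ≤ 90 := by
  have h : ∀ i, (if j = 0 then tru else occF c t i : PForm (AVar n)).size ≤ 1 := fun i => by
    split_ifs
    · exact le_rfl
    · exact size_occF_le c t i
  simp only [occNextF, disj, List.foldr_cons, List.foldr_nil, PForm.size]
  linarith [size_kindF_le (n := n) false false false t, size_kindF_le (n := n) true false false t,
    size_occF_le (n := n) c t j, h (j - 1), h (j + 1), size_isBinF_le (n := n) t,
    size_isPushF_le (n := n) t]

theorem size_binValF_le (c : Bool) (t : ℕ) : (binValF c t : PForm (AVar n)).size ≤ 50 := by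
  have := fun a b c => size_kindF_le (n := n) a b c t
  simp only [binValF, disj, List.foldr_cons, List.foldr_nil, PForm.size]
  linarith [this true false true, this true true false, this true true true,
    size_valF_le (n := n) c t 0, size_valF_le (n := n) c t 1]

theorem size_lookupF_le (hn : n ≠ 0) {Q : ℕ} (hQ : 2 ≤ Q) (hnQ : n ≤ Q)
    {Y : ℕ → PForm (AVar n)} (hY : ∀ i, (Y i).size ≤ 1) (t : ℕ) :
    (lookupF Y t).size ≤ 8 * Q ^ 2 := by
  have h₁ : 2 ^ idxLen n ≤ Q := (Nat.pow_log_le_self 2 hn).trans hnQ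
  have h₂ : idxLen n ≤ Q := (Nat.lt_two_pow_self.le).trans h₁
  have key : ∀ i < 2 ^ idxLen n, (and (conj ((List.range (idxLen n)).map fun j =>
      lit (i.testBit j) (var (AVar.x (t * blockLen n + 3 + j))))) (Y i)).size ≤
        (Q * (2 + 1) + 1) + 1 + 1 := by
    intro i _
    have := size_conj_range_le (M := 2) h₂ (f := fun j =>
      lit (i.testBit j) (var (AVar.x (t * blockLen n + 3 + j) : AVar n)))
        fun j _ => (size_lit_le _ _).trans le_rfl
    simp only [PForm.size]
    linarith [hY i]
  refine (size_disj_range_le h₁ key).trans ?_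
  nlinarith

theorem size_valNextF_le (hn : n ≠ 0) {Q : ℕ} (hQ : 2 ≤ Q) (hnQ : n ≤ Q)
    {Y : ℕ → PForm (AVar n)} (hY : ∀ i, (Y i).size ≤ 1) (c : Bool) (t j : ℕ) :
    (valNextF c Y t j).size ≤ 60 * Q ^ 2 := by
  have h₁ : (if j = 0 then pushValF Y t else valF c t (j - 1)).size ≤ 8 * Q ^ 2 + 18 := by
    split_ifs
    · simp only [pushValF, PForm.size]
      linarith [size_kindF_le (n := n) false false true t, size_kindF_le (n := n) false true true t,
        size_lookupF_le hn hQ hnQ hY t]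
    · exact (size_valF_le ..).trans (by omega)
  have h₂ : (if j = 0 then neg (valF c t 0) else valF c t j : PForm (AVar n)).size ≤ 2 := by
    split_ifs
    · exact Nat.succ_le_succ (size_valF_le ..)
    · exact (size_valF_le ..).trans (by omega)
  have h₃ : (if j = 0 then binValF c t else valF c t (j + 1) : PForm (AVar n)).size ≤ 50 := by
    split_ifs
    · exact size_binValF_le ..
    · exact (size_valF_le ..).trans (by omega)
  have h₄ : 4 ≤ Q ^ 2 := by nlinarith
  simp only [valNextF, disj, List.foldr_cons, List.foldr_nil, PForm.size]
  linarith [size_kindF_le (n := n) false false false t, size_kindF_le (n := n) true false false t,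
    size_valF_le (n := n) c t j, size_isBinF_le (n := n) t, size_isPushF_le (n := n) t]

theorem size_satCompF_le (hn : n ≠ 0) {Q : ℕ} (hQ : 2 ≤ Q) (hnQ : n ≤ Q)
    {Y : ℕ → PForm (AVar n)} (hY : ∀ i, (Y i).size ≤ 1) (c : Bool) :
    (satCompF c Y).size ≤ 500 * Q ^ 4 := by
  have hN : numBlocks n ≤ Q := (Nat.div_le_self _ _).trans hnQ
  have h₂ : 2 * Q ≤ Q ^ 2 := by nlinarith
  have h₃ : 2 * Q ^ 2 ≤ Q ^ 3 := by nlinarith [sq_nonneg Q]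
  have h₄ : 2 * Q ^ 3 ≤ Q ^ 4 := by nlinarith [Nat.zero_le (Q ^ 3)]
  have inner : ∀ t, ∀ j < numBlocks n + 1, (and (iff (occF c (t + 1) j) (occNextF c t j))
      (iff (valF c (t + 1) j) (valNextF c Y t j))).size ≤ 180 * Q ^ 2 := by
    intro t j _
    simp only [PForm.size, size_iff]
    linarith [size_occF_le (n := n) c (t + 1) j, size_occNextF_le (n := n) c t j,
      size_valF_le (n := n) c (t + 1) j, size_valNextF_le hn hQ hnQ hY c t j]
  refine (size_conj_range_le (M := 330 * Q ^ 3) hN fun t _ => ?_).trans (by nlinarith)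
  have := size_conj_range_le (Nat.add_le_add_right hN 1) (inner t)
  simp only [PForm.size, size_iff]
  nlinarith [size_okF_le (n := n) c (t + 1), size_okNextF_le (n := n) c t]

theorem size_satOutF_le (c : Bool) : (satOutF c : PForm (AVar n)).size ≤ 10 := by
  simp only [satOutF, conj, List.foldr_cons, List.foldr_nil, PForm.size]
  linarith [size_okF_le (n := n) c (numBlocks n), size_occF_le (n := n) c (numBlocks n) 0,
    size_occF_le (n := n) c (numBlocks n) 1, size_valF_le (n := n) c (numBlocks n) 0]

theorem size_gateF_le {f : Bool → Bool → PForm V} {A B : PForm V} {M : ℕ} (hM : 1 ≤ M)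
    (hf : ∀ p q, (f p q).size = 1) (hA : A.size ≤ M) (hB : B.size ≤ M) :
    (gateF f A B).size ≤ 40 * M := by
  simp only [gateF, disj, List.foldr_cons, List.foldr_nil, PForm.size, hf]
  linarith

theorem size_wireBF (j : ℕ) : (wireBF j : PForm (AVar n)).size = 1 := by
  unfold wireBF; split_ifs <;> rfl

theorem size_outBF_le (B : Circuit) (i : ℕ) : (outBF B i : PForm (AVar n)).size ≤ 1 := by
  unfold outBF
  by_cases h : i < B.outs.length
  · simp [h, size_wireBF]
  · rw [List.getD_eq_default _ _ (by simpa using h)]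
    exact le_rfl

theorem size_compBF_le (B : Circuit) {Q : ℕ} (hB : B.size ≤ Q) :
    (compBF B : PForm (AVar n)).size ≤ 90 * Q + 1 := by
  refine (size_conj_le (M := 85) ?_ ?_).trans (show Q * (85 + 1) + 1 ≤ _ by omega)
  · exact (List.length_ofFn ..).trans_le hB
  · simp only [List.forall_mem_ofFn_iff, size_iff]
    intro g
    have := size_gateF_le (f := fun p q => (const ((B.gates[g]).op p q) : PForm (AVar n))) le_rfl
      (fun _ _ => size_const _) (size_wireBF (n := n) (B.gates[g]).left).le
      (size_wireBF (n := n) (B.gates[g]).right).le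
    simp only [PForm.size] at this ⊢
    omega

theorem size_exactlyOneF_le {m Q : ℕ} (hQ : 2 ≤ Q) (hm : m ≤ 2 * Q) {f : ℕ → PForm (AVar n)}
    (hf : ∀ j, (f j).size = 1) : (exactlyOneF m f).size ≤ 40 * Q ^ 2 := by
  have h₁ := size_disj_range_le hm fun j _ => (hf j).le
  have h₂ : (conj ((List.range m).map fun i => conj ((List.range i).map fun j =>
      neg (and (f i) (f j))))).size ≤ 2 * Q * ((2 * Q * (4 + 1) + 1) + 1) + 1 := by
    refine size_conj_range_le hm fun i hi => size_conj_range_le (hi.le.trans hm) fun j _ => ?_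
    simp only [PForm.size, hf]; omega
  simp only [exactlyOneF, PForm.size]
  nlinarith

theorem size_wireCF (z : Fin n → Bool) (j : ℕ) : (wireCF z j).size = 1 := by
  unfold wireCF
  split_ifs
  · exact size_const _
  · rfl

theorem size_selectF_le {m Q : ℕ} (hQ : 2 ≤ Q) (hm : m ≤ 2 * Q) {f wire : ℕ → PForm (AVar n)}
    (hf : ∀ j, (f j).size = 1) (hw : ∀ j, (wire j).size = 1) :
    (selectF m f wire).size ≤ 9 * Q := by
  refine (size_disj_range_le (M := 3) hm fun j _ => ?_).trans (by omega)
  simp only [PForm.size, hf, hw]; omega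

theorem size_isCircuitF_le {s Q : ℕ} (hQ : 2 ≤ Q) (hn : n ≤ Q) (hs : s ≤ Q) :
    (isCircuitF s : PForm (AVar n)).size ≤ 200 * Q ^ 3 := by
  have h₂ : 2 * Q ≤ Q ^ 2 := by nlinarith
  have h₃ : 2 * Q ^ 2 ≤ Q ^ 3 := by nlinarith [sq_nonneg Q]
  have h₄ : (conj ((List.range s).map fun g =>
      and (exactlyOneF (n + g) fun j => var (.left g j))
        (exactlyOneF (n + g) fun j => var (.right g j))) : PForm (AVar n)).size ≤
      Q * ((80 * Q ^ 2 + 1) + 1) + 1 := by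
    refine size_conj_range_le hs fun g hg => ?_
    have := fun f hf => size_exactlyOneF_le (n := n) (m := n + g) (f := f) hQ (by omega) hf
    simp only [PForm.size]
    linarith [this (fun j => var (.left g j)) fun _ => rfl,
      this (fun j => var (.right g j)) fun _ => rfl]
  have h₅ := size_exactlyOneF_le (n := n) (m := n + s) (f := fun j => var (.out j)) hQ (by omega)
    fun _ => rfl
  simp only [isCircuitF, PForm.size]
  nlinarith

theorem size_compCF_le {s Q : ℕ} (hQ : 2 ≤ Q) (hn : n ≤ Q) (hs : s ≤ Q) (z : Fin n → Bool) :
    (compCF s z).size ≤ 800 * Q ^ 2 := by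
  refine (size_conj_range_le (M := 730 * Q) hs fun g hg => ?_).trans (by nlinarith)
  have h := fun f hf => size_selectF_le (n := n) (m := n + g) (f := f) hQ (by omega) hf
    (size_wireCF z)
  have := size_gateF_le (f := fun p q => (var (.op g p q) : PForm (AVar n)))
    (show 1 ≤ 9 * Q by omega) (fun _ _ => rfl) (h (fun j => var (.left g j)) fun _ => rfl)
    (h (fun j => var (.right g j)) fun _ => rfl)
  simp only [size_iff]
  have hv : (var (AVar.v z g)).size = 1 := rfl
  omega

/-- The size of `alpha` is polynomial. -/
theorem size_alpha_le {s Q : ℕ} {A : Finset (Fin n → Bool)} {B : Circuit} (hn₀ : n ≠ 0)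
    (hQ : 2 ≤ Q) (hn : n ≤ Q) (hs : s ≤ Q) (hA : A.card ≤ Q) (hB : B.size ≤ Q) :
    (alpha n s A B).size ≤ 2000 * Q ^ 4 := by
  have h₂ : 2 * Q ≤ Q ^ 2 := by nlinarith
  have h₃ : 2 * Q ^ 2 ≤ Q ^ 3 := by nlinarith [sq_nonneg Q]
  have h₄ : 2 * Q ^ 3 ≤ Q ^ 4 := by nlinarith [Nat.zero_le (Q ^ 3)]
  have h₅ := size_satCompF_le hn₀ hQ hn (Y := fun i => var (.y i)) (fun _ => le_rfl) false
  have h₆ := size_satCompF_le hn₀ hQ hn (size_outBF_le B) true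
  have h₇ := size_isCircuitF_le hQ hn hs
  have h₈ : ∀ b : (Fin n → Bool) → Bool, (disj (A.toList.map fun z => imp (compCF s z)
      (neg (iff (outCF s z) (const (b z)))))).size ≤ Q * (850 * Q ^ 2 + 1) + 1 := by
    intro b
    refine size_disj_le (by simpa using hA) ?_
    simp only [List.mem_map, forall_exists_index, and_imp, forall_apply_eq_imp_iff₂]
    intro z _
    have := size_selectF_le (n := n) (m := n + s) (f := fun j => var (.out j)) hQ (by omega)
      (fun _ => rfl) (size_wireCF z)
    simp only [PForm.size, size_iff, size_const, outCF]
    linarith [size_compCF_le hQ hn hs z]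
  have h₉ := h₈ fun z => @decide (Satisfiable z) (Classical.propDecidable _)
  simp only [alpha, PForm.size, conj, List.foldr_cons, List.foldr_nil]
  nlinarith [size_compBF_le (n := n) B hB, size_satOutF_le (n := n) false,
    size_satOutF_le (n := n) true]

end size

/-! ### Polynomial bounds -/

/-- `f` is bounded by a polynomial. -/
def PolyBounded (f : ℕ → ℕ) : Prop := ∃ C e, ∀ m, f m ≤ C * (m + 1) ^ e

namespace PolyBounded

variable {f g : ℕ → ℕ}

theorem const (c : ℕ) : PolyBounded fun _ => c := ⟨c, 0, by simp⟩

theorem id : PolyBounded fun m => m := ⟨1, 1, by simp⟩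

theorem add (hf : PolyBounded f) (hg : PolyBounded g) : PolyBounded fun m => f m + g m := by
  obtain ⟨C, e, h⟩ := hf
  obtain ⟨D, d, h'⟩ := hg
  refine ⟨C + D, e + d, fun m => ?_⟩
  have h₁ : (m + 1) ^ e ≤ (m + 1) ^ (e + d) := Nat.pow_le_pow_right (by omega) (by omega)
  have h₂ : (m + 1) ^ d ≤ (m + 1) ^ (e + d) := Nat.pow_le_pow_right (by omega) (by omega)
  calc f m + g m ≤ C * (m + 1) ^ e + D * (m + 1) ^ d := Nat.add_le_add (h m) (h' m)
    _ ≤ C * (m + 1) ^ (e + d) + D * (m + 1) ^ (e + d) := by gcongr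
    _ = _ := by ring

theorem mul (hf : PolyBounded f) (hg : PolyBounded g) : PolyBounded fun m => f m * g m := by
  obtain ⟨C, e, h⟩ := hf
  obtain ⟨D, d, h'⟩ := hg
  refine ⟨C * D, e + d, fun m => (Nat.mul_le_mul (h m) (h' m)).trans_eq ?_⟩
  rw [pow_add]; ring

theorem pow (hf : PolyBounded f) (k : ℕ) : PolyBounded fun m => f m ^ k := by
  induction k with
  | zero => simpa using const 1
  | succ k ih => simpa only [pow_succ] using ih.mul hf

theorem exists_le (hf : PolyBounded f) : ∃ c, ∀ m, f m ≤ m ^ c + c := by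
  obtain ⟨C, e, h⟩ := hf
  refine ⟨e + C * 2 ^ e, fun m => (h m).trans ?_⟩
  rcases lt_or_ge m 2 with hm | hm
  · have : (m + 1) ^ e ≤ 2 ^ e := Nat.pow_le_pow_left (by omega) e
    nlinarith [Nat.mul_le_mul_left C this, Nat.zero_le (m ^ (e + C * 2 ^ e))]
  · have h₁ : (m + 1) ^ e ≤ 2 ^ e * m ^ e := by
      rw [← mul_pow]; exact Nat.pow_le_pow_left (by omega) e
    have h₂ : C * 2 ^ e ≤ m ^ (C * 2 ^ e) := (Nat.lt_pow_self hm).le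
    calc C * (m + 1) ^ e ≤ C * (2 ^ e * m ^ e) := Nat.mul_le_mul_left _ h₁
      _ = m ^ e * (C * 2 ^ e) := by ring
      _ ≤ m ^ e * m ^ (C * 2 ^ e) := Nat.mul_le_mul_left _ h₂
      _ = m ^ (e + C * 2 ^ e) := (pow_add _ _ _).symm
      _ ≤ _ := Nat.le_add_right _ _

end PolyBounded

/-! ### Short derivations from circuits for `SAT_n` -/

/-- Strings of length `r ^ 2` have at least `r` blocks, and room for `r` atoms. -/
theorem le_numBlocks_sq {r : ℕ} (hr : 10 ≤ r) :
    r ≤ numBlocks (r ^ 2) ∧ r ≤ 2 ^ idxLen (r ^ 2) := by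
  have hpow : r ^ 2 < 2 ^ (r - 2) := by
    induction r, hr using Nat.le_induction with
    | base => norm_num
    | succ r hr ih =>
      rw [show r + 1 - 2 = (r - 2) + 1 by omega, pow_succ 2]
      nlinarith
  have hne : r ^ 2 ≠ 0 := by positivity
  have hlog : Nat.log 2 (r ^ 2) < r - 2 := Nat.log_lt_of_lt_pow hne hpow
  constructor
  · have hb : blockLen (r ^ 2) ≤ r := by simp only [blockLen, idxLen]; omega
    rw [numBlocks, Nat.le_div_iff_mul_le (by simp [blockLen])]
    exact (Nat.mul_le_mul_left _ hb).trans_eq (sq r).symm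
  · have := Nat.lt_pow_succ_log_self (b := 2) one_lt_two (r ^ 2)
    rw [pow_succ 2] at this
    simp only [idxLen]
    nlinarith

/-- If `SAT_n` has circuits with `s` gates, every tautology with sufficiently few symbols
compared to `n` has a short derivation from one instance of `alpha n s`. -/
theorem exists_efDerivable_of_satInCircuit : ∃ K, ∀ (H : Set (PForm ℕ)) (n s Q : ℕ)
    (A : Finset (Fin n → Bool)) (B : Circuit) (φ : PForm ℕ), φ.Tautology →
    φ.size + 1 ≤ numBlocks n → φ.size + 1 ≤ 2 ^ idxLen n → SatInCircuit n s → B.WellFormed n →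
    2 ≤ Q → n ≤ Q → s ≤ Q → A.card ≤ Q → B.size ≤ Q →
    (∀ σ : AVar n → PForm ℕ, (alpha n s A B).subst σ ∈ H) →
    EFDerivable H φ (K * (2000 * Q ^ 4 * (n + 1) + φ.size) ^ 2) := by
  obtain ⟨K, hK⟩ := exists_efDerivable_of_fold_eq
  refine ⟨K, fun H n s Q A B φ hφ hn hn' hsat hB hQ hnQ hs hA hBQ hH => ?_⟩
  obtain ⟨C, o, hC, hout, rfl, hcomp⟩ := hsat.exists_size_eq
  obtain ⟨x, S, f, g, hx, hS, hf, hsize⟩ := exists_isParse (n := n) (neg φ) hn hn'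
  have hn₀ : n ≠ 0 := by
    rintro rfl
    simp [numBlocks] at hn
  obtain ⟨E, Γ, h₁, h₂, h₃⟩ := hK H _ φ (hH (instanceSubst x S f B C o))
    (fold_alpha_instance hx hS hφ hf hB hC hout hcomp A)
  refine ⟨E, Γ, h₁, h₂, h₃.trans ?_⟩
  have hstack : ∀ (t j : ℕ) (Z : ℕ → PForm ℕ), (∀ i, (Z i).size ≤ 1) →
      (((S t).getD j fls).subst Z).size ≤ n + 1 := by
    intro t j Z hZ
    refine (PForm.size_subst_le le_rfl hZ _).trans ?_
    rw [mul_one]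
    by_cases h : j < (S t).length
    · rw [List.getD_eq_getElem _ _ h]
      exact (hsize t _ (List.getElem_mem h)).trans (Nat.le_succ n)
    · rw [List.getD_eq_default _ _ (not_lt.1 h)]
      exact Nat.succ_le_succ (Nat.zero_le n)
  have hconst : ∀ b, (PForm.const b : PForm ℕ).size ≤ n + 1 := fun b =>
    (size_const b).trans_le (Nat.succ_le_succ (Nat.zero_le n))
  have hσ : ∀ v, (instanceSubst x S f B C o v).size ≤ n + 1 := by
    intro v
    rcases v with _ | _ | _ | _ | ⟨_ | _, t, j⟩ | _ | _ | _ | _ | _ | _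
    case y => exact Nat.succ_le_succ (Nat.zero_le n)
    case ok => exact Nat.succ_le_succ (Nat.zero_le n)
    case val.false => exact hstack _ _ _ fun _ => le_rfl
    case val.true => exact hstack _ _ _ fun _ => (size_const _).le
    all_goals exact hconst _
  have := (PForm.size_subst_le (by omega) hσ (alpha n C.gates.length A B)).trans
    (Nat.mul_le_mul_right _ (size_alpha_le hn₀ hQ hnQ hs hA hBQ))
  gcongr

end EFAlpha

theorem theorem4 (k : ℕ) (hk : 3 ≤ k)
    (n₀ c : ℕ) (A : ∀ n : ℕ, Finset (Fin n → Bool)) (B' B : ℕ → EFAlpha.Circuit)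
    (hα : ∀ n : ℕ, n₀ ≤ n → EFAlpha.IsAlphaChoice n (n ^ k) c (A n) (B' n) (B n))
    (T : Set (EFAlpha.PForm ℕ)) (hT : ∀ φ ∈ T, φ.Tautology)
    (hard : ¬ EFAlpha.HavePSizeEFDerivations
      (EFAlpha.alphaInstances n₀ (fun n => n ^ k) A B) T) :
    {n : ℕ | ¬ EFAlpha.SatInCircuit n (n ^ k)}.Infinite := by
  intro hfin
  refine hard ?_
  obtain ⟨N, hN⟩ := hfin.bddAbove
  obtain ⟨K, hK⟩ := EFAlpha.exists_efDerivable_of_satInCircuit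
  -- a tautology with `m` symbols is derived from an instance of `α_n`, where `n = len m`
  set len : ℕ → ℕ := fun m => (m + (N + n₀ + 10)) ^ 2 with hlen
  set Q : ℕ → ℕ := fun m => (len m ^ k) ^ c + c + len m ^ k + len m + 2 with hQ
  have hpoly : EFAlpha.PolyBounded fun m => K * (2000 * Q m ^ 4 * (len m + 1) + m) ^ 2 := by
    have h₁ : EFAlpha.PolyBounded len := (EFAlpha.PolyBounded.id.add (.const _)).pow 2
    have h₂ : EFAlpha.PolyBounded Q :=
      (((((h₁.pow k).pow c).add (.const c)).add (h₁.pow k)).add h₁).add (.const 2)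
    exact (EFAlpha.PolyBounded.const K).mul
      (((((EFAlpha.PolyBounded.const 2000).mul (h₂.pow 4)).mul (h₁.add (.const 1))).add .id).pow 2)
  obtain ⟨d, hd⟩ := hpoly.exists_le
  refine ⟨d, fun φ hφ => ?_⟩
  have hle : φ.size + (N + n₀ + 10) ≤ len φ.size := by
    simp only [hlen]; nlinarith
  obtain ⟨hblocks, hidx⟩ := EFAlpha.le_numBlocks_sq (r := φ.size + (N + n₀ + 10)) (by omega)
  rw [show (φ.size + (N + n₀ + 10)) ^ 2 = len φ.size from rfl] at hblocks hidx
  have hchoice := hα (len φ.size) (by omega)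
  have hsat : EFAlpha.SatInCircuit (len φ.size) (len φ.size ^ k) := by
    by_contra h
    have : len φ.size ≤ N := hN h
    omega
  obtain ⟨E, Γ, h₁, h₂, h₃⟩ := hK (EFAlpha.alphaInstances n₀ (fun n => n ^ k) A B) (len φ.size)
    (len φ.size ^ k) (Q φ.size) (A _) (B _) φ (hT φ hφ) (by omega) (by omega) hsat
    hchoice.wellFormed_B (by simp only [hQ]; omega) (by simp only [hQ]; omega)
    (by simp only [hQ]; omega) (hchoice.card_A.trans (by simp only [hQ]; omega))
    (hchoice.size_B.trans (by simp only [hQ]; omega))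
    fun σ => ⟨len φ.size, by omega, σ, rfl⟩
  exact ⟨E, Γ, h₁, h₂, h₃.trans (hd _)⟩
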